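/- Let $Z_i=(X_i,Y_i)$, $i=0,1,2,\dots$, be a strictly stationary sequence of random vectors in $\mathbb R^2$ that is $m$-dependent for some integer $m\ge 0$, i.e. for every $t$ the family $(Z_i)_{i\le t}$ is independent of $(Z_i)_{i\ge t+m+1}$. Let $F_X,F_Y$ be the distribution functions of $X_0$ and $Y_0$, and let $q_k^X=\min\{x: F_X(x)\ge k\}$ and $q_k^Y=\min\{y: F_Y(y)\ge k\}$ be their quantiles. Let $K\subset(0,1)$ be finite and non-empty, and let $\Delta>0$. Assume that $X_0$ and $Y_0$ have Lebesgue densities $f_X$ and $f_Y$ such that, for every $k\in K$, $f_X$ is strictly positive and continuous in a neighbourhood of $q_k^X$, and $f_Y$ is strictly positive and continuous in a neighbourhood of $q_k^Y$. For a sample $x_1,\dots,x_n$ with order statistics $x_{(1)}\le\dots\le x_{(n)}$ let $\hat q_k^x=x_{(\lceil nk\rceil)}$ if $nk\notin\mathbb Z$ and $\hat q_k^x=\tfrac12\,(x_{(nk)}+x_{(nk+1)})$ if $nk\in\mathbb Z$. Let $\hat q_k^X$ and $\hat q_k^Y$ be these empirical quantiles of the first $n$ observations $X_0,\dots,X_{n-1}$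 and $Y_0,\dots,Y_{n-1}$, and put $$\hat Q_n=\sqrt n\,\max_{k\in K}\bigl(|\hat q_k^X-\hat q_k^Y|-\Delta\bigr).$$ Let $\mathbb G=(\mathbb G_1,\mathbb G_2)$ be a bivariate Brownian bridge on $[0,1]$ with the long-run covariance structure of the data, i.e. a centred, jointly Gaussian process such that, for all $s,t\in[0,1]$, $$\operatorname{Cov}(\mathbb G_a(s),\mathbb G_b(t))=\sum_{h=-m}^{m}\operatorname{Cov}\bigl(I^a_0(s),I^b_h(t)\bigr),\qquad a,b\in\{1,2\},$$ where $I^1_i(s)=\mathbf 1\{F_X(X_i)\le s\}$ and $I^2_i(s)=\mathbf 1\{F_Y(Y_i)\le s\}$, and where, by stationarity, $\operatorname{Cov}(I^a_0(s),I^b_{-h}(t))$ stands for $\operatorname{Cov}(I^a_h(s),I^b_0(t))$ when $h>0$. If the null hypothesis $H_0:\ \max_{k\in K}|q_k^X-q_k^Y|\le\Delta$ holds, then, as $n\to\infty$, $$\hat Q_n\ \overset{d}{\longrightarrow}\ \max_{k\in K,\ |q_k^X-q_k^Y|=\Delta}\operatorname{sign}(q_k^X-q_k^Y)\left(\frac{\mathbb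 G_1(k)}{f_X(q_k^X)}-\frac{\mathbb G_2(k)}{f_Y(q_k^Y)}\right)$$ weakly in $[-\infty,\infty)\subset[-\infty,\infty]$, where the right-hand side is defined to be $-\infty$ if no $k\in K$ satisfies $|q_k^X-q_k^Y|=\Delta$. -/

import Mathlib

open MeasureTheory ProbabilityTheory Filter Topology

noncomputable section

/-- The pairs `(X i, Y i)`, `i ∈ ℕ`, form a strictly stationary sequence: for every shift `h`, the
shifted sequence has the same law (on the space of sequences) as the sequence itself. -/
def StrictlyStationary {Ω : Type*} [MeasurableSpace Ω] (P : Measure Ω) (X Y : ℕ → Ω → ℝ) : Prop :=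
  ∀ h : ℕ, P.map (fun ω (i : ℕ) => (X (i + h) ω, Y (i + h) ω)) =
    P.map (fun ω (i : ℕ) => (X i ω, Y i ω))

/-- The pairs `(X i, Y i)` are `m`-dependent: for every `t`, the family of pairs with index `≤ t`
is independent of the family of pairs with index `≥ t + m + 1`. -/
def MDependent {Ω : Type*} [MeasurableSpace Ω] (P : Measure Ω) (X Y : ℕ → Ω → ℝ) (m : ℕ) : Prop :=
  ∀ t : ℕ, IndepFun (fun ω (i : Set.Iic t) => (X i ω, Y i ω))
    (fun ω (i : Set.Ici (t + m + 1)) => (X i ω, Y i ω)) P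

/-- `f` is a Lebesgue density of the law `ν` on `ℝ`. -/
structure IsDensity (ν : Measure ℝ) (f : ℝ → ℝ) : Prop where
  measurable : Measurable f
  nonneg : ∀ x, 0 ≤ f x
  eq_withDensity : ν = volume.withDensity (fun x => ENNReal.ofReal (f x))

/-- `f` is strictly positive and continuous in a neighbourhood of `q`. -/
def PosContNear (f : ℝ → ℝ) (q : ℝ) : Prop :=
  ∃ U ∈ 𝓝 q, ContinuousOn f U ∧ ∀ x ∈ U, 0 < f x

/-- The `k`-quantile of the law `ν`: the smallest `x` with `ν (-∞, x] ≥ k`. -/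
def quantile (ν : Measure ℝ) (k : ℝ) : ℝ := sInf {x : ℝ | k ≤ cdf ν x}

/-- The `j`-th order statistic `x_(j)`, `1 ≤ j ≤ n`, of a sample of size `n`: the `j`-th entry of
the sample sorted in nondecreasing order (with value `0` for `j` out of range). -/
def orderStat {n : ℕ} (x : Fin n → ℝ) (j : ℕ) : ℝ :=
  if h : 1 ≤ j ∧ j ≤ n then x (Tuple.sort x ⟨j - 1, by omega⟩) else 0

open Classical in
/-- The empirical `k`-quantile: `x_(⌈n k⌉)` if `n k` is not an integer, and the mean of
`x_(n k)` and `x_(n k + 1)` if it is. -/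
def empQuantile {n : ℕ} (x : Fin n → ℝ) (k : ℝ) : ℝ :=
  if ∃ z : ℤ, (n : ℝ) * k = z then
    (orderStat x ⌈(n : ℝ) * k⌉₊ + orderStat x (⌈(n : ℝ) * k⌉₊ + 1)) / 2
  else orderStat x ⌈(n : ℝ) * k⌉₊

/-- The normalized maximum statistic `√n * max_{k ∈ K} (|q̂_k^x - q̂_k^y| - Δ)`. -/
def maxStat (K : Finset ℝ) (hK : K.Nonempty) (Δ : ℝ) {n : ℕ} (x y : Fin n → ℝ) : ℝ :=
  √(n : ℝ) * K.sup' hK (fun k => |empQuantile x k - empQuantile y k| - Δ)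

/-- The indicator of the event `F (U i) ≤ s`, where `F` is the distribution function of `U 0`. -/
def levelInd {Ω : Type*} [MeasurableSpace Ω] (P : Measure Ω) (U : ℕ → Ω → ℝ) (s : ℝ) (i : ℕ) :
    Ω → ℝ :=
  Set.indicator {ω | cdf (P.map (U 0)) (U i ω) ≤ s} (fun _ => 1)

/-- The long-run covariance `∑_{h = -m}^{m} Cov (U_0, V_h)` of two jointly stationary sequences,
where, by stationarity, `Cov (U_0, V_{-h})` is written as `Cov (U_h, V_0)`. -/
def longRunCov {Ω : Type*} [MeasurableSpace Ω] (P : Measure Ω) (m : ℕ) (U V : ℕ → Ω → ℝ) : ℝ :=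
  cov[U 0, V 0; P] + ∑ h ∈ Finset.Icc 1 m, (cov[U 0, V h; P] + cov[U h, V 0; P])

/-- `(G₁, G₂)`, with time parameter in `[0, 1]`, is a bivariate Brownian bridge whose covariance
structure is the long-run covariance of the sequence of pairs `(X i, Y i)`: a centred, jointly
Gaussian process with the covariance kernel of the limit of the two empirical processes.
For independent pairs (`m = 0`) each coordinate has the covariance `min s t - s * t`. Only the
finite-dimensional laws are prescribed; no regularity of the paths is asked for. -/
structure IsLongRunBrownianBridge {Ω Ω' : Type*} [MeasurableSpace Ω] [MeasurableSpace Ω']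
    (P : Measure Ω) (X Y : ℕ → Ω → ℝ) (m : ℕ) (P' : Measure Ω') (G₁ G₂ : ℝ → Ω' → ℝ) : Prop where
  gaussian : IsGaussianProcess
    (Sum.elim (fun s : Set.Icc (0 : ℝ) 1 => G₁ s) (fun s : Set.Icc (0 : ℝ) 1 => G₂ s)) P'
  mean_fst : ∀ s ∈ Set.Icc (0 : ℝ) 1, ∫ ω, G₁ s ω ∂P' = 0
  mean_snd : ∀ s ∈ Set.Icc (0 : ℝ) 1, ∫ ω, G₂ s ω ∂P' = 0
  cov_fst : ∀ s ∈ Set.Icc (0 : ℝ) 1, ∀ t ∈ Set.Icc (0 : ℝ) 1,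
    cov[G₁ s, G₁ t; P'] = longRunCov P m (levelInd P X s) (levelInd P X t)
  cov_snd : ∀ s ∈ Set.Icc (0 : ℝ) 1, ∀ t ∈ Set.Icc (0 : ℝ) 1,
    cov[G₂ s, G₂ t; P'] = longRunCov P m (levelInd P Y s) (levelInd P Y t)
  cov_fst_snd : ∀ s ∈ Set.Icc (0 : ℝ) 1, ∀ t ∈ Set.Icc (0 : ℝ) 1,
    cov[G₁ s, G₂ t; P'] = longRunCov P m (levelInd P X s) (levelInd P Y t)

/-- The levels `k ∈ K` with `|q_k^X - q_k^Y| = Δ`. -/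
def boundaryLevels (K : Finset ℝ) (Δ : ℝ) (νX νY : Measure ℝ) : Finset ℝ :=
  K.filter (fun k => |quantile νX k - quantile νY k| = Δ)

/-- The limit variable: the maximum over the boundary levels of
`sign (q_k^X - q_k^Y) * (G₁ k / f_X (q_k^X) - G₂ k / f_Y (q_k^Y))`, which is `-∞`
if there are no boundary levels. -/
def limitVar {Ω' : Type*} (K : Finset ℝ) (Δ : ℝ) (νX νY : Measure ℝ) (fX fY : ℝ → ℝ)
    (G₁ G₂ : ℝ → Ω' → ℝ) (ω : Ω') : EReal :=
  (boundaryLevels K Δ νX νY).sup (fun k =>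
    ((Real.sign (quantile νX k - quantile νY k) *
      (G₁ k ω / fX (quantile νX k) - G₂ k ω / fY (quantile νY k)) : ℝ) : EReal))

end

/-! The statistic is replaced, up to `o_P(1)`, by a continuous function of finitely many values of
the two empirical processes `E_n = √n (F_n - F)`, to which a central limit theorem applies.

Quantiles: each satisfies a Bahadur representation `√n (q̂_k - q_k) = -E_n(q_k) / f(q_k) + o_P(1)`
(`whp_abs_empQuantile_sub_le`). By duality, `√n (x_(j) - q) ≤ x` compares `E_n(q + x/√n)` with a
deterministic sequence tending to `-f(q) x`, and a Chebyshev bound replaces `E_n(q + x/√n)` by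
`E_n(q)`. A finite grid of thresholds `x` suffices, so no uniform control of `E_n` is needed.

Levels: if `|q_k^X - q_k^Y| < Δ`, the `k`-th term tends to `-∞` like `-√n` (`whp_interior_level`).
If equality holds, then, since `Δ > 0`, the absolute value is linear near `q_k^X - q_k^Y` with slope
its sign (`whp_boundary_level`). Hence only boundary levels matter in the maximum
(`abs_sub_sup'_le`).

Limit: the Cramér–Wold device (`tendstoInDistribution_multivariate`) reduces joint convergence to a
scalar bounded `m`-dependent sequence (`BoundedMDependent.tendsto_charFun`). There, blocks of length
`l` separated by gaps of length `m` are i.i.d., and the gaps carry a share of the variance that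
vanishes as `l → ∞`. Without boundary levels, the exponential of the statistic tends to `0` in
probability, which is convergence to `⊥`. -/

/-- A uniformly bounded, strictly stationary, `m`-dependent sequence of real random variables. -/
structure BoundedMDependent {Ω : Type*} [MeasurableSpace Ω] (P : Measure Ω) (m : ℕ) (C : ℝ)
    (ξ : ℕ → Ω → ℝ) : Prop where
  measurable : ∀ i, Measurable (ξ i)
  bound : ∀ i ω, |ξ i ω| ≤ C
  stationary : ∀ h : ℕ, P.map (fun ω (i : ℕ) => ξ (i + h) ω) = P.map (fun ω (i : ℕ) => ξ i ω)
  indep : ∀ t : ℕ, IndepFun (fun ω (i : Set.Iic t) => ξ i ω)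
    (fun ω (i : Set.Ici (t + m + 1)) => ξ i ω) P

/-! ### Second moments of sums of bounded `m`-dependent sequences -/

section

variable {Ω : Type*} [MeasurableSpace Ω] {P : Measure Ω} {m : ℕ} {C : ℝ} {ξ : ℕ → Ω → ℝ}

/-- Stationarity and `m`-dependence of the pairs enter the proof only through such scalar images. -/
lemma BoundedMDependent.of_comp {X Y : ℕ → Ω → ℝ}
    (hX : ∀ i, Measurable (X i)) (hY : ∀ i, Measurable (Y i)) (hstat : StrictlyStationary P X Y)
    (hdep : MDependent P X Y m) {g : ℝ × ℝ → ℝ} (hg : Measurable g) (hC : ∀ z, |g z| ≤ C) :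
    BoundedMDependent P m C (fun i ω => g (X i ω, Y i ω)) where
  measurable i := hg.comp ((hX i).prodMk (hY i))
  bound i ω := hC _
  stationary h := by
    have key : Measurable (fun (z : ℕ → ℝ × ℝ) (i : ℕ) => g (z i)) :=
      measurable_pi_lambda _ fun i => hg.comp (measurable_pi_apply i)
    have h1 := congrArg (Measure.map (fun (z : ℕ → ℝ × ℝ) (i : ℕ) => g (z i))) (hstat h)
    rw [Measure.map_map key (measurable_pi_lambda _ fun i => (hX _).prodMk (hY _)),
      Measure.map_map key (measurable_pi_lambda _ fun i => (hX _).prodMk (hY _))] at h1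
    exact h1
  indep t := (hdep t).comp
    (φ := fun (z : Set.Iic t → ℝ × ℝ) i => g (z i))
    (ψ := fun (z : Set.Ici (t + m + 1) → ℝ × ℝ) i => g (z i))
    (measurable_pi_lambda _ fun i => hg.comp (measurable_pi_apply i))
    (measurable_pi_lambda _ fun i => hg.comp (measurable_pi_apply i))

/-- A sequence of random variables each of which is independent of the preceding ones is
independent. -/
lemma iIndepFun_of_indepFun_past {Z : ℕ → Ω → ℝ} [IsProbabilityMeasure P]
    (h : ∀ n, IndepFun (fun ω (j : Set.Iic n) => Z j ω) (Z (n + 1)) P) : iIndepFun Z P := by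
  rw [iIndepFun_iff_measure_inter_preimage_eq_mul]
  intro S
  -- Adding indices in increasing order keeps the new index above all of `S`, so the intersection
  -- over `S` is an event of the past.
  induction S using Finset.induction_on_max with
  | empty => simp
  | insert a S hS ih =>
    intro sets hsets
    have ha : a ∉ S := fun h => lt_irrefl _ (hS a h)
    rw [Finset.prod_insert ha, Finset.set_biInter_insert,
      ← ih (fun i hi => hsets i (Finset.mem_insert_of_mem hi))]
    rcases a with _ | n
    · obtain rfl : S = ∅ := Finset.eq_empty_of_forall_notMem fun x hx => by
        simpa using hS x hx
      simp
    · have hpre : (⋂ i ∈ S, Z i ⁻¹' sets i) = (fun ω (j : Set.Iic n) => Z j ω) ⁻¹'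
          (⋂ j : Set.Iic n, (fun x => x j) ⁻¹' (if (j : ℕ) ∈ S then sets j else Set.univ)) := by
        ext ω
        simp only [Set.mem_iInter, Set.mem_preimage, Subtype.forall, Set.mem_Iic]
        constructor
        · intro H j hj
          split_ifs with hjS
          · exact H j hjS
          · trivial
        · intro H j hj
          have := H j (Nat.lt_succ_iff.mp (hS j hj))
          rwa [if_pos hj] at this
      rw [hpre, Set.inter_comm, mul_comm]
      refine (h n).measure_inter_preimage_eq_mul _ _ ?_ (hsets _ (Finset.mem_insert_self _ _))
      refine MeasurableSet.iInter fun j => measurable_pi_apply j ?_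
      split_ifs with hj
      · exact hsets _ (Finset.mem_insert_of_mem hj)
      · exact MeasurableSet.univ

namespace BoundedMDependent

lemma memLp [IsProbabilityMeasure P] (h : BoundedMDependent P m C ξ) (i : ℕ) :
    MemLp (ξ i) 2 P :=
  MemLp.of_bound (h.measurable i).aestronglyMeasurable C (ae_of_all _ (h.bound i))

lemma identDistrib_shift (h : BoundedMDependent P m C ξ) {E : Type*} [MeasurableSpace E]
    {F : (ℕ → ℝ) → E} (hF : Measurable F) (s : ℕ) :
    IdentDistrib (fun ω => F (fun i => ξ (i + s) ω)) (fun ω => F (fun i => ξ i ω)) P P := by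
  have h1 : Measurable (fun ω (i : ℕ) => ξ (i + s) ω) :=
    measurable_pi_lambda _ fun i => h.measurable _
  have h2 : Measurable (fun ω (i : ℕ) => ξ i ω) :=
    measurable_pi_lambda _ fun i => h.measurable _
  exact IdentDistrib.comp ⟨h1.aemeasurable, h2.aemeasurable, h.stationary s⟩ hF

lemma identDistrib (h : BoundedMDependent P m C ξ) (i : ℕ) : IdentDistrib (ξ i) (ξ 0) P P := by
  simpa using h.identDistrib_shift (measurable_pi_apply 0) i

lemma covariance_shift (h : BoundedMDependent P m C ξ) (i j s : ℕ) :
    cov[ξ (i + s), ξ (j + s); P] = cov[ξ i, ξ j; P] := by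
  have h2 := h.identDistrib_shift (F := fun x => (x i - ∫ ω, ξ 0 ω ∂P) * (x j - ∫ ω, ξ 0 ω ∂P))
    (by fun_prop) s
  have := h2.integral_eq
  simp only [covariance]
  rw [(h.identDistrib (i + s)).integral_eq, (h.identDistrib (j + s)).integral_eq,
    (h.identDistrib i).integral_eq, (h.identDistrib j).integral_eq]
  exact this

lemma indepFun (h : BoundedMDependent P m C ξ) {i j : ℕ} (hij : i + m < j) :
    IndepFun (ξ i) (ξ j) P := by
  have hφ : Measurable (fun x : Set.Iic i → ℝ => x ⟨i, Set.mem_Iic.mpr le_rfl⟩) :=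
    measurable_pi_apply _
  have hψ : Measurable (fun x : Set.Ici (i + m + 1) → ℝ => x ⟨j, Set.mem_Ici.mpr hij⟩) :=
    measurable_pi_apply _
  exact (h.indep i).comp hφ hψ

lemma covariance_eq_zero [IsProbabilityMeasure P] (h : BoundedMDependent P m C ξ) {i j : ℕ}
    (hij : i + m < j ∨ j + m < i) : cov[ξ i, ξ j; P] = 0 := by
  rcases hij with hij | hij
  · exact (h.indepFun hij).covariance_eq_zero (h.memLp i) (h.memLp j)
  · rw [covariance_comm]
    exact (h.indepFun hij).covariance_eq_zero (h.memLp j) (h.memLp i)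

/-- Expand `0 ≤ Var (ξ i - ξ j)` and use that all variances agree. -/
lemma covariance_le [IsProbabilityMeasure P] (h : BoundedMDependent P m C ξ) (i j : ℕ) :
    cov[ξ i, ξ j; P] ≤ Var[ξ 0; P] := by
  have h1 := variance_sub (h.memLp i) (h.memLp j)
  rw [(h.identDistrib i).variance_eq, (h.identDistrib j).variance_eq] at h1
  have := variance_nonneg (ξ i - ξ j) P
  linarith

/-- Each index is correlated with at most `2 m + 1` indices, itself included. The index set is
arbitrary because the bound is also applied to the indices discarded by the blocking. -/
lemma variance_sum_le [IsProbabilityMeasure P] (h : BoundedMDependent P m C ξ) (A : Finset ℕ) :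
    Var[fun ω => ∑ i ∈ A, ξ i ω; P] ≤ (2 * m + 1) * A.card * Var[ξ 0; P] := by
  rw [variance_fun_sum' fun i _ => h.memLp i]
  calc ∑ i ∈ A, ∑ j ∈ A, cov[ξ i, ξ j; P]
      ≤ ∑ i ∈ A, (2 * m + 1) * Var[ξ 0; P] := by
        refine Finset.sum_le_sum fun i hi => ?_
        calc ∑ j ∈ A, cov[ξ i, ξ j; P] = ∑ j ∈ A with j ∈ Finset.Icc (i - m) (i + m),
              cov[ξ i, ξ j; P] := by
              rw [Finset.sum_filter]
              refine Finset.sum_congr rfl fun j hj => ?_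
              split_ifs with hij
              · rfl
              · refine h.covariance_eq_zero ?_
                simp only [Finset.mem_Icc] at hij
                omega
          _ ≤ ∑ j ∈ A with j ∈ Finset.Icc (i - m) (i + m), Var[ξ 0; P] :=
              Finset.sum_le_sum fun j _ => h.covariance_le i j
          _ ≤ ∑ j ∈ Finset.Icc (i - m) (i + m), Var[ξ 0; P] := by
              refine Finset.sum_le_sum_of_subset_of_nonneg (fun j hj => ?_)
                fun _ _ _ => variance_nonneg _ _
              exact (Finset.mem_filter.mp hj).2
          _ ≤ (2 * m + 1) * Var[ξ 0; P] := by
              rw [Finset.sum_const, nsmul_eq_mul, Nat.card_Icc]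
              refine mul_le_mul_of_nonneg_right ?_ (variance_nonneg _ _)
              exact_mod_cast (by omega : i + m + 1 - (i - m) ≤ 2 * m + 1)
    _ = (2 * m + 1) * A.card * Var[ξ 0; P] := by
        rw [Finset.sum_const, nsmul_eq_mul]; ring

/-- Once `l ≥ m`, the new term is correlated with exactly its last `m` predecessors at most, so the
increment is constant and the variance is affine in `l`. Reversing the sum and shifting by
stationarity turns each covariance into one with `ξ 0`. -/
lemma variance_sum_range_succ [IsProbabilityMeasure P] (h : BoundedMDependent P m C ξ) {l : ℕ}
    (hl : m ≤ l) :
    Var[fun ω => ∑ i ∈ Finset.range (l + 1), ξ i ω; P] =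
      Var[fun ω => ∑ i ∈ Finset.range l, ξ i ω; P] + longRunCov P m ξ ξ := by
  have hS : MemLp (fun ω => ∑ i ∈ Finset.range l, ξ i ω) 2 P :=
    memLp_finsetSum _ fun i _ => h.memLp i
  simp_rw [Finset.sum_range_succ]
  rw [variance_fun_add hS (h.memLp l), covariance_fun_sum_left' (fun i _ => h.memLp i) (h.memLp l),
    (h.identDistrib l).variance_eq, longRunCov, covariance_self (h.measurable 0).aemeasurable]
  have h1 : ∑ i ∈ Finset.range l, cov[ξ i, ξ l; P] = ∑ s ∈ Finset.Icc 1 m, cov[ξ 0, ξ s; P] := by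
    have e1 : ∑ i ∈ Finset.range l, cov[ξ i, ξ l; P]
        = ∑ i ∈ Finset.range l, cov[ξ 0, ξ (i + 1); P] := by
      rw [← Finset.sum_range_reflect]
      refine Finset.sum_congr rfl fun i hi => ?_
      have hi := Finset.mem_range.mp hi
      have := h.covariance_shift 0 (i + 1) (l - 1 - i)
      rwa [zero_add, show i + 1 + (l - 1 - i) = l by omega] at this
    have e2 : ∑ s ∈ Finset.Icc 1 m, cov[ξ 0, ξ s; P]
        = ∑ i ∈ Finset.range m, cov[ξ 0, ξ (i + 1); P] := by
      rw [Finset.range_eq_Ico, Finset.sum_Ico_add' (fun s => cov[ξ 0, ξ s; P]) 0 m 1]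
      rfl
    rw [e1, e2]
    refine (Finset.sum_subset (Finset.range_mono hl) fun i _ hi => ?_).symm
    refine h.covariance_eq_zero (Or.inl ?_)
    simp only [Finset.mem_range] at hi
    omega
  have h2 : ∑ s ∈ Finset.Icc 1 m, (cov[ξ 0, ξ s; P] + cov[ξ s, ξ 0; P])
      = 2 * ∑ s ∈ Finset.Icc 1 m, cov[ξ 0, ξ s; P] := by
    rw [Finset.mul_sum]
    refine Finset.sum_congr rfl fun s _ => ?_
    rw [covariance_comm (ξ s)]; ring
  rw [h1, h2]; ring

/-- The divisor is the full block length, gap included: this quotient is the limit variance of the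
block sums. -/
lemma tendsto_variance_sum_div [IsProbabilityMeasure P] (h : BoundedMDependent P m C ξ) :
    Tendsto (fun l : ℕ => Var[fun ω => ∑ i ∈ Finset.range l, ξ i ω; P] / (l + m : ℕ)) atTop
      (𝓝 (longRunCov P m ξ ξ)) := by
  have key : ∀ k, Var[fun ω => ∑ i ∈ Finset.range (m + k), ξ i ω; P] =
      Var[fun ω => ∑ i ∈ Finset.range m, ξ i ω; P] + k * longRunCov P m ξ ξ := by
    intro k
    induction k with
    | zero => simp
    | succ k ih => rw [← add_assoc, h.variance_sum_range_succ (by omega), ih]; push_cast; ring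
  set V := Var[fun ω => ∑ i ∈ Finset.range m, ξ i ω; P]
  set σ := longRunCov P m ξ ξ
  have hinv : Tendsto (fun l : ℕ => ((l + m : ℕ) : ℝ)⁻¹) atTop (𝓝 0) :=
    tendsto_inv_atTop_zero.comp (tendsto_natCast_atTop_atTop.comp (tendsto_add_atTop_nat m))
  -- For `l ≥ m` the variance is `V + (l - m) σ = (l + m) σ + (V - 2 m σ)`.
  have h1 : Tendsto (fun l : ℕ => σ + (V - 2 * m * σ) * ((l + m : ℕ) : ℝ)⁻¹) atTop (𝓝 σ) := by
    simpa using (hinv.const_mul (V - 2 * m * σ)).const_add σ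
  refine h1.congr' ?_
  filter_upwards [eventually_ge_atTop (m + 1)] with l hl
  obtain ⟨k, rfl⟩ := Nat.exists_eq_add_of_le (show m ≤ l by omega)
  have hpos : ((m + k + m : ℕ) : ℝ) ≠ 0 := by
    have : m + k + m ≠ 0 := by omega
    exact_mod_cast this
  rw [key]
  field_simp
  push_cast
  ring

end BoundedMDependent
end

/-! ### Central limit theorem for `m`-dependent sequences by blocking -/

section

variable {Ω : Type*} [MeasurableSpace Ω] {P : Measure Ω} {m : ℕ} {C : ℝ} {ξ : ℕ → Ω → ℝ}

/-- A limit along `n` may be computed through a family of approximations `b l n`, `l → ∞`. -/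
lemma tendsto_of_tendsto_approx {a : ℕ → ℂ} {b : ℕ → ℕ → ℂ} {B : ℕ → ℂ} {β : ℂ}
    {e : ℕ → ℕ → ℝ} {E : ℕ → ℝ} (hb : ∀ᶠ l in atTop, Tendsto (b l) atTop (𝓝 (B l)))
    (hB : Tendsto B atTop (𝓝 β))
    (hab : ∀ᶠ l in atTop, ∀ᶠ n in atTop, ‖a n - b l n‖ ≤ e l n)
    (he : ∀ᶠ l in atTop, Tendsto (e l) atTop (𝓝 (E l))) (hE : Tendsto E atTop (𝓝 0)) :
    Tendsto a atTop (𝓝 β) := by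
  rw [Metric.tendsto_atTop']
  intro ε hε
  have h1 : ∀ᶠ l in atTop, dist (B l) β < ε / 3 := Metric.tendsto_nhds.mp hB _ (by positivity)
  have h2 : ∀ᶠ l in atTop, E l < ε / 3 := hE.eventually_lt_const (by positivity)
  obtain ⟨l, hbl, habl, hel, h1, h2⟩ := (hb.and (hab.and (he.and (h1.and h2)))).exists
  have h3 : ∀ᶠ n in atTop, dist (b l n) (B l) < ε / 3 := Metric.tendsto_nhds.mp hbl _ (by positivity)
  have h4 : ∀ᶠ n in atTop, e l n < ε / 3 := hel.eventually_lt_const h2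
  obtain ⟨N, hN⟩ := eventually_atTop.mp (habl.and (h3.and h4))
  refine ⟨N, fun n hn => ?_⟩
  obtain ⟨i1, i2, i3⟩ := hN n hn.le
  rw [← dist_eq_norm] at i1
  have := dist_triangle4 (a n) (b l n) (B l) β
  linarith

lemma sq_integral_abs_le [IsProbabilityMeasure P] {D : Ω → ℝ} (hD : MemLp D 2 P) :
    (∫ ω, |D ω| ∂P) ^ 2 ≤ ∫ ω, D ω ^ 2 ∂P := by
  have h := variance_eq_sub hD.abs
  have h0 := variance_nonneg |D| P
  have h1 : ∫ ω, (|D| ^ 2) ω ∂P = ∫ ω, D ω ^ 2 ∂P := by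
    simp only [Pi.pow_apply, Pi.abs_apply, sq_abs]
  have h2 : ∫ ω, |D| ω ∂P = ∫ ω, |D ω| ∂P := rfl
  rw [h1, h2] at h
  linarith

/-- From `|exp (i a) - exp (i b)| ≤ |a - b|` and Cauchy–Schwarz; it prices the discarded indices by
their variance. -/
lemma norm_charFun_map_sub_le [IsProbabilityMeasure P] {A B : Ω → ℝ} (hA : MemLp A 2 P)
    (hB : MemLp B 2 P) (t : ℝ) :
    ‖charFun (P.map A) t - charFun (P.map B) t‖ ≤ |t| * √(∫ ω, (A ω - B ω) ^ 2 ∂P) := by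
  have hAm := hA.aestronglyMeasurable.aemeasurable
  have hBm := hB.aestronglyMeasurable.aemeasurable
  have hD : MemLp (fun ω => A ω - B ω) 2 P := hA.sub hB
  have hint : ∀ {F : Ω → ℝ}, AEMeasurable F P →
      Integrable (fun ω => Complex.exp (t * F ω * Complex.I)) P := by
    intro F hF
    refine Integrable.of_bound (by fun_prop) 1 (ae_of_all _ fun ω => ?_)
    rw [← Complex.ofReal_mul, Complex.norm_exp_ofReal_mul_I]
  rw [charFun_apply_real, charFun_apply_real, integral_map hAm (by fun_prop),
    integral_map hBm (by fun_prop), ← integral_sub (hint hAm) (hint hBm)]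
  calc ‖∫ ω, (Complex.exp (t * A ω * Complex.I) - Complex.exp (t * B ω * Complex.I)) ∂P‖
      ≤ ∫ ω, |t| * |A ω - B ω| ∂P := by
        refine norm_integral_le_of_norm_le ((hD.integrable (by norm_num)).abs.const_mul _)
          (ae_of_all _ fun ω => ?_)
        have e : Complex.exp (t * A ω * Complex.I) - Complex.exp (t * B ω * Complex.I)
            = Complex.exp ((t * B ω : ℝ) * Complex.I) *
              (Complex.exp (Complex.I * (t * (A ω - B ω) : ℝ)) - 1) := by
          rw [mul_sub, ← Complex.exp_add, mul_one]
          push_cast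
          ring_nf
        rw [e, norm_mul, Complex.norm_exp_ofReal_mul_I, one_mul, ← abs_mul, ← Real.norm_eq_abs]
        exact Real.norm_exp_I_mul_ofReal_sub_one_le
    _ = |t| * ∫ ω, |A ω - B ω| ∂P := integral_const_mul _ _
    _ ≤ |t| * √(∫ ω, (A ω - B ω) ^ 2 ∂P) := by
        gcongr
        exact Real.le_sqrt_of_sq_le (sq_integral_abs_le hD)

namespace BoundedMDependent

/-- The sum of the first `l` terms of the `j`-th block of length `l + m`. -/
def blockSum (ξ : ℕ → Ω → ℝ) (m l j : ℕ) (ω : Ω) : ℝ :=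
  ∑ i ∈ Finset.range l, ξ (i + j * (l + m)) ω

lemma identDistrib_blockSum (h : BoundedMDependent P m C ξ) (l j : ℕ) :
    IdentDistrib (blockSum ξ m l j) (blockSum ξ m l 0) P P := by
  have := h.identDistrib_shift (F := fun x => ∑ i ∈ Finset.range l, x i) (by fun_prop) (j * (l + m))
  have e : blockSum ξ m l 0 = fun ω => ∑ i ∈ Finset.range l, ξ i ω := by
    funext ω
    simp [blockSum]
  rw [e]
  exact this

lemma iIndepFun_blockSum [IsProbabilityMeasure P] (h : BoundedMDependent P m C ξ) {l : ℕ}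
    (hl : 0 < l) : iIndepFun (blockSum ξ m l) P := by
  refine iIndepFun_of_indepFun_past fun n => ?_
  -- The last index used by the blocks `0, …, n`; the next block starts exactly at `t + m + 1`.
  set t := n * (l + m) + (l - 1) with ht
  have ht' : t + m + 1 = (n + 1) * (l + m) := by rw [ht, add_mul]; omega
  -- The value `0` only makes the functional total; the indices that occur are all at most `t`.
  have hφ : Measurable (fun (x : Set.Iic t → ℝ) (j : Set.Iic n) =>
      ∑ i ∈ Finset.range l, if hi : i + j * (l + m) ≤ t then x ⟨i + j * (l + m), hi⟩ else 0) := by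
    refine measurable_pi_lambda _ fun j => Finset.measurable_fun_sum _ fun i _ => ?_
    split_ifs
    · exact measurable_pi_apply _
    · exact measurable_const
  have hψ : Measurable (fun (x : Set.Ici (t + m + 1) → ℝ) =>
      ∑ i ∈ Finset.range l, x ⟨i + (n + 1) * (l + m), by
        rw [ht', Set.mem_Ici]; exact Nat.le_add_left _ _⟩) :=
    Finset.measurable_fun_sum _ fun i _ => measurable_pi_apply _
  have hi := (h.indep t).comp hφ hψ
  refine (hi.congr (ae_of_all _ fun ω => ?_) (ae_of_all _ fun ω => rfl))
  funext j
  refine Finset.sum_congr rfl fun i hi => ?_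
  have h1 := Finset.mem_range.mp hi
  have h2 : (j : ℕ) * (l + m) ≤ n * (l + m) := Nat.mul_le_mul_right _ j.2
  simp only
  rw [dif_pos (by omega)]

/-- The indices below `r * (l + m)` which lie in the first `l` places of their block. -/
def blockIndices (m l r : ℕ) : Finset ℕ :=
  (Finset.range r ×ˢ Finset.range l).image fun p => p.2 + p.1 * (l + m)

lemma injOn_block (m l r : ℕ) : Set.InjOn (fun p : ℕ × ℕ => p.2 + p.1 * (l + m))
    (Finset.range r ×ˢ Finset.range l : Finset (ℕ × ℕ)) := by
  rintro ⟨j, i⟩ h1 ⟨j', i'⟩ h2 h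
  simp only [Finset.coe_product, Set.mem_prod, Finset.mem_coe, Finset.mem_range] at h1 h2 h
  have hi : (i + j * (l + m)) / (l + m) = j := by
    rw [Nat.add_mul_div_right _ _ (by omega), Nat.div_eq_of_lt (by omega), zero_add]
  have hi' : (i' + j' * (l + m)) / (l + m) = j' := by
    rw [Nat.add_mul_div_right _ _ (by omega), Nat.div_eq_of_lt (by omega), zero_add]
  rw [h] at hi
  obtain rfl : j = j' := hi.symm.trans hi'
  simpa using h

lemma card_blockIndices (m l r : ℕ) : (blockIndices m l r).card = r * l := by
  rw [blockIndices, Finset.card_image_of_injOn (injOn_block m l r), Finset.card_product,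
    Finset.card_range, Finset.card_range]

lemma blockIndices_subset (m l n : ℕ) : blockIndices m l (n / (l + m)) ⊆ Finset.range n := by
  intro x hx
  simp only [blockIndices, Finset.mem_image, Finset.mem_product, Finset.mem_range, Prod.exists] at hx
  obtain ⟨j, i, ⟨hj, hi⟩, rfl⟩ := hx
  have h1 : (j + 1) * (l + m) ≤ n / (l + m) * (l + m) := Nat.mul_le_mul_right _ hj
  have h2 := Nat.div_mul_le_self n (l + m)
  rw [add_mul] at h1
  rw [Finset.mem_range]
  omega

lemma sum_blockSum {Ω : Type*} (ξ : ℕ → Ω → ℝ) (m l r : ℕ) (ω : Ω) :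
    ∑ j ∈ Finset.range r, blockSum ξ m l j ω = ∑ i ∈ blockIndices m l r, ξ i ω := by
  rw [blockIndices, Finset.sum_image (injOn_block m l r), Finset.sum_product]
  rfl

lemma integral_sum_eq_zero [IsProbabilityMeasure P] (h : BoundedMDependent P m C ξ)
    (h0 : ∫ ω, ξ 0 ω ∂P = 0) (A : Finset ℕ) : ∫ ω, ∑ i ∈ A, ξ i ω ∂P = 0 := by
  rw [integral_finsetSum _ fun i _ => (h.memLp i).integrable (by norm_num)]
  exact Finset.sum_eq_zero fun i _ => by rw [(h.identDistrib i).integral_eq, h0]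

lemma tendsto_natDiv_div {p : ℕ} (hp : 0 < p) :
    Tendsto (fun n : ℕ => ((n / p : ℕ) : ℝ) / n) atTop (𝓝 (p : ℝ)⁻¹) := by
  have := tendsto_nat_floor_mul_div_atTop (R := ℝ) (a := (p : ℝ)⁻¹) (by positivity)
  refine (this.comp tendsto_natCast_atTop_atTop).congr fun n => ?_
  simp only [Function.comp]
  rw [← Nat.floor_div_eq_div (K := ℝ), inv_mul_eq_div]

/-- For fixed `l` the `r = n / (l + m)` block sums are i.i.d., so the classical theorem applies with
normalisation `√r`; Slutsky with `√r / √n → √(1 / (l + m))` restores `√n`. -/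
lemma tendsto_charFun_blocks [IsProbabilityMeasure P] (h : BoundedMDependent P m C ξ)
    (h0 : ∫ ω, ξ 0 ω ∂P = 0) {l : ℕ} (hl : 0 < l) (t : ℝ) :
    Tendsto (fun n : ℕ => charFun (P.map fun ω => (√(n : ℝ))⁻¹ *
        ∑ i ∈ blockIndices m l (n / (l + m)), ξ i ω) t) atTop
      (𝓝 (Complex.exp (-((Var[fun ω => ∑ i ∈ Finset.range l, ξ i ω; P] / (l + m : ℕ) : ℝ)
        * t ^ 2 / 2)))) := by
  set v := Var[blockSum ξ m l 0; P]
  have hv : Var[fun ω => ∑ i ∈ Finset.range l, ξ i ω; P] = v := by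
    simp only [v]
    congr 1
    funext ω
    simp [blockSum]
  have hp : 0 < l + m := by omega
  have hlaw : HasLaw (id : ℝ → ℝ) (gaussianReal 0 v.toNNReal) (gaussianReal 0 v.toNNReal) :=
    ⟨aemeasurable_id, Measure.map_id⟩
  have hmem : MemLp (blockSum ξ m l 0) 2 P := memLp_finsetSum _ fun i _ => h.memLp _
  have hmean : ∫ ω, blockSum ξ m l 0 ω ∂P = 0 := by
    have := h.integral_sum_eq_zero h0 (Finset.range l)
    simpa [blockSum] using this
  have clt := tendstoInDistribution_inv_sqrt_mul_sum_sub hlaw hmem (h.iIndepFun_blockSum hl)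
    (h.identDistrib_blockSum l)
  have hdiv : Tendsto (fun n : ℕ => n / (l + m)) atTop atTop := Nat.tendsto_div_const_atTop hp.ne'
  have clt' : TendstoInDistribution (fun (n : ℕ) ω => (√((n / (l + m) : ℕ) : ℝ))⁻¹ *
      (∑ k ∈ Finset.range (n / (l + m)), blockSum ξ m l k ω - (n / (l + m) : ℕ) * P[blockSum ξ m l 0]))
      atTop id (fun _ => P) (gaussianReal 0 v.toNNReal) :=
    ⟨fun n => clt.forall_aemeasurable _, clt.aemeasurable_limit, clt.tendsto.comp hdiv⟩
  have hc : Tendsto (fun n : ℕ => √((n / (l + m) : ℕ) : ℝ) / √(n : ℝ)) atTop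
      (𝓝 (√((l + m : ℕ) : ℝ)⁻¹)) := by
    refine ((Real.continuous_sqrt.tendsto _).comp (tendsto_natDiv_div hp)).congr fun n => ?_
    exact Real.sqrt_div (by positivity) _
  have hcm : TendstoInMeasure P (fun (n : ℕ) (_ : Ω) => √((n / (l + m) : ℕ) : ℝ) / √(n : ℝ)) atTop
      (fun _ => √((l + m : ℕ) : ℝ)⁻¹) :=
    tendstoInMeasure_of_tendsto_ae (fun n => aestronglyMeasurable_const) (ae_of_all _ fun _ => hc)
  have key := clt'.continuous_comp_prodMk_of_tendstoInMeasure_const (g := fun p : ℝ × ℝ => p.2 * p.1)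
    (by fun_prop) hcm (fun _ => aemeasurable_const)
  have key' := ProbabilityMeasure.tendsto_iff_tendsto_charFun.mp key.tendsto t
  simp only [ProbabilityMeasure.coe_mk] at key'
  convert key' using 2
  · rename_i n
    congr 2
    funext ω
    rw [hmean, mul_zero, sub_zero, sum_blockSum]
    rcases Nat.eq_zero_or_pos (n / (l + m)) with h0 | h0
    · simp [h0, blockIndices]
    · have : √((n / (l + m) : ℕ) : ℝ) ≠ 0 := by positivity
      field_simp
  · have : (fun ω : ℝ => √((l + m : ℕ) : ℝ)⁻¹ * id ω) = fun x => √((l + m : ℕ) : ℝ)⁻¹ * x := rfl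
    rw [this, charFun_map_mul, charFun_gaussianReal]
    congr 1
    have hv0 : 0 ≤ v := variance_nonneg _ _
    have h2 : ((√((l + m : ℕ) : ℝ)⁻¹ : ℝ) : ℂ) ^ 2 = (((l + m : ℕ) : ℝ)⁻¹ : ℝ) := by
      rw [← Complex.ofReal_pow, Real.sq_sqrt (by positivity)]
    rw [hv, Real.coe_toNNReal _ hv0]
    push_cast at h2 ⊢
    rw [mul_pow, h2]
    ring

/-- The **central limit theorem** for bounded stationary `m`-dependent sequences, in terms of
characteristic functions. -/
theorem tendsto_charFun [IsProbabilityMeasure P] (h : BoundedMDependent P m C ξ)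
    (h0 : ∫ ω, ξ 0 ω ∂P = 0) (t : ℝ) :
    Tendsto (fun n : ℕ => charFun (P.map fun ω => (√(n : ℝ))⁻¹ * ∑ i ∈ Finset.range n, ξ i ω) t)
      atTop (𝓝 (Complex.exp (-((longRunCov P m ξ ξ : ℝ) * t ^ 2 / 2)))) := by
  set V := (2 * m + 1) * Var[ξ 0; P]
  have hV : 0 ≤ V := mul_nonneg (by positivity) (variance_nonneg _ _)
  have hmem : ∀ (n : ℕ) (A : Finset ℕ), MemLp (fun ω => (√(n : ℝ))⁻¹ * ∑ i ∈ A, ξ i ω) 2 P :=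
    fun n A => (memLp_finsetSum A fun i _ => h.memLp i).const_mul _
  refine tendsto_of_tendsto_approx
    (b := fun l n => charFun (P.map fun ω => (√(n : ℝ))⁻¹ *
        ∑ i ∈ blockIndices m l (n / (l + m)), ξ i ω) t)
    -- The inner factor is the proportion of indices below `n` that lie outside the retained blocks;
    -- it tends to `m / (l + m)` in `n`, which vanishes as `l → ∞`.
    (e := fun l n => |t| * √(V * (1 - ((n / (l + m) : ℕ) : ℝ) / n * l)))
    (E := fun l => |t| * √(V * (m * ((l + m : ℕ) : ℝ)⁻¹)))
    (B := fun l => Complex.exp (-((Var[fun ω => ∑ i ∈ Finset.range l, ξ i ω; P] / (l + m : ℕ) : ℝ)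
        * t ^ 2 / 2))) ?_ ?_ ?_ ?_ ?_
  · filter_upwards [eventually_gt_atTop 0] with l hl using h.tendsto_charFun_blocks h0 hl t
  · have hcont : Continuous fun x : ℝ => Complex.exp (-((x : ℂ) * t ^ 2 / 2)) := by fun_prop
    exact (hcont.tendsto _).comp h.tendsto_variance_sum_div
  · filter_upwards [eventually_gt_atTop 0] with l hl
    filter_upwards [eventually_gt_atTop 0] with n hn
    refine (norm_charFun_map_sub_le (hmem n _) (hmem n _) t).trans ?_
    gcongr
    set A := Finset.range n \ blockIndices m l (n / (l + m))
    have hA : (A.card : ℝ) = n - (n / (l + m) : ℕ) * l := by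
      have hle := Finset.card_le_card (blockIndices_subset m l n)
      rw [Finset.card_sdiff_of_subset (blockIndices_subset m l n), Nat.cast_sub hle,
        card_blockIndices, Finset.card_range, Nat.cast_mul]
    have e : ∀ ω, (√(n : ℝ))⁻¹ * ∑ i ∈ Finset.range n, ξ i ω - (√(n : ℝ))⁻¹ *
        ∑ i ∈ blockIndices m l (n / (l + m)), ξ i ω = (√(n : ℝ))⁻¹ * ∑ i ∈ A, ξ i ω := by
      intro ω
      rw [← Finset.sum_sdiff (blockIndices_subset m l n)]
      ring
    have hn' : (0 : ℝ) < n := by exact_mod_cast hn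
    have hvar : ∫ ω, (∑ i ∈ A, ξ i ω) ^ 2 ∂P ≤ (2 * m + 1) * A.card * Var[ξ 0; P] := by
      refine le_trans (le_of_eq ?_) (h.variance_sum_le A)
      rw [variance_of_integral_eq_zero (Finset.measurable_fun_sum _ fun i _ => h.measurable i).aemeasurable
        (h.integral_sum_eq_zero h0 A)]
    simp_rw [e, mul_pow]
    rw [integral_const_mul, inv_pow, Real.sq_sqrt hn'.le]
    calc (n : ℝ)⁻¹ * ∫ ω, (∑ i ∈ A, ξ i ω) ^ 2 ∂P
        ≤ (n : ℝ)⁻¹ * ((2 * m + 1) * A.card * Var[ξ 0; P]) := by gcongr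
      _ = V * (1 - ((n / (l + m) : ℕ) : ℝ) / n * l) := by
        rw [hA]; simp only [V]; field_simp
  · filter_upwards [eventually_gt_atTop 0] with l hl
    have hp : 0 < l + m := by omega
    have hlim : Tendsto (fun n : ℕ => |t| * √(V * (1 - ((n / (l + m) : ℕ) : ℝ) / n * l))) atTop
        (𝓝 (|t| * √(V * (1 - ((l + m : ℕ) : ℝ)⁻¹ * l)))) :=
      ((Real.continuous_sqrt.tendsto _).comp
        ((((tendsto_natDiv_div hp).mul_const (l : ℝ)).const_sub 1).const_mul V)).const_mul |t|
    convert hlim using 5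
    have : ((l + m : ℕ) : ℝ) ≠ 0 := by exact_mod_cast hp.ne'
    field_simp
    push_cast
    ring
  · have hinv : Tendsto (fun l : ℕ => ((l + m : ℕ) : ℝ)⁻¹) atTop (𝓝 0) :=
      tendsto_inv_atTop_zero.comp (tendsto_natCast_atTop_atTop.comp (tendsto_add_atTop_nat m))
    have := ((Real.continuous_sqrt.tendsto _).comp
      ((hinv.const_mul (m : ℝ)).const_mul V)).const_mul |t|
    simpa using this

end BoundedMDependent
end

/-! ### Asymptotic calculus in probability -/

section

variable {Ω : Type*} [MeasurableSpace Ω] {P : Measure Ω}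

/-- The property `p n` holds with probability tending to one. -/
def Whp (P : Measure Ω) (p : ℕ → Ω → Prop) : Prop :=
  Tendsto (fun n => P {ω | ¬ p n ω}) atTop (𝓝 0)

/-- The sequence `V` is bounded in probability. -/
def BddInProb (P : Measure Ω) (V : ℕ → Ω → ℝ) : Prop :=
  ∀ δ : ENNReal, 0 < δ → ∃ M : ℝ, ∀ᶠ n in atTop, P {ω | ¬ |V n ω| ≤ M} ≤ δ

lemma Whp.mono {p q : ℕ → Ω → Prop} (hp : Whp P p) (h : ∀ᶠ n in atTop, ∀ ω, p n ω → q n ω) :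
    Whp P q := by
  refine tendsto_of_tendsto_of_tendsto_of_le_of_le' tendsto_const_nhds hp
    (Eventually.of_forall fun _ => zero_le) ?_
  filter_upwards [h] with n hn
  exact measure_mono fun ω hω hpω => hω (hn ω hpω)

/-- Only monotonicity and subadditivity of `P` are used, so the events need not be measurable. -/
lemma Whp.and {p q : ℕ → Ω → Prop} (hp : Whp P p) (hq : Whp P q) :
    Whp P fun n ω => p n ω ∧ q n ω := by
  have h : Tendsto (fun n => P {ω | ¬ p n ω} + P {ω | ¬ q n ω}) atTop (𝓝 0) := by
    simpa using hp.add hq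
  refine tendsto_of_tendsto_of_tendsto_of_le_of_le tendsto_const_nhds h (fun _ => zero_le)
    fun n => (measure_mono fun ω hω => ?_).trans (measure_union_le _ _)
  simp only [Set.mem_ofPred_eq, Set.mem_union] at hω ⊢
  tauto

lemma whp_of_eventually {p : ℕ → Ω → Prop} (h : ∀ᶠ n in atTop, ∀ ω, p n ω) : Whp P p := by
  refine tendsto_const_nhds.congr' ?_
  filter_upwards [h] with n hn
  simp [hn]

lemma whp_forall_finset {ι : Type*} {p : ι → ℕ → Ω → Prop} (s : Finset ι)
    (h : ∀ i ∈ s, Whp P (p i)) : Whp P fun n ω => ∀ i ∈ s, p i n ω := by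
  classical
  induction s using Finset.induction_on with
  | empty => exact whp_of_eventually (Eventually.of_forall fun _ _ => by simp)
  | insert a s ha ih =>
    refine ((h a (Finset.mem_insert_self _ _)).and
      (ih fun i hi => h i (Finset.mem_insert_of_mem hi))).mono (Eventually.of_forall ?_)
    rintro n ω ⟨h1, h2⟩ i hi
    rcases Finset.mem_insert.mp hi with rfl | hi
    exacts [h1, h2 i hi]

lemma BddInProb.whp {V : ℕ → Ω → ℝ} (hV : BddInProb P V) {M : ℕ → ℝ}
    (hM : Tendsto M atTop atTop) : Whp P fun n ω => |V n ω| ≤ M n := by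
  refine ENNReal.tendsto_nhds_zero.mpr fun δ hδ => ?_
  obtain ⟨M₀, h⟩ := hV δ hδ
  filter_upwards [h, hM.eventually_ge_atTop M₀] with n hn hMn
  refine (measure_mono fun ω hω h' => ?_).trans hn
  exact hω (h'.trans hMn)

lemma BddInProb.add {V W : ℕ → Ω → ℝ} (hV : BddInProb P V) (hW : BddInProb P W) :
    BddInProb P fun n ω => V n ω + W n ω := by
  intro δ hδ
  obtain ⟨M, hM⟩ := hV (δ / 2) (ENNReal.half_pos hδ.ne')
  obtain ⟨N, hN⟩ := hW (δ / 2) (ENNReal.half_pos hδ.ne')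
  refine ⟨M + N, ?_⟩
  filter_upwards [hM, hN] with n h1 h2
  calc P {ω | ¬ |V n ω + W n ω| ≤ M + N}
      ≤ P {ω | ¬ |V n ω| ≤ M} + P {ω | ¬ |W n ω| ≤ N} := by
        refine (measure_mono fun ω hω => ?_).trans (measure_union_le _ _)
        simp only [Set.mem_ofPred_eq, Set.mem_union] at hω ⊢
        by_contra! hcon
        exact hω ((abs_add_le _ _).trans (add_le_add hcon.1 hcon.2))
    _ ≤ δ / 2 + δ / 2 := add_le_add h1 h2
    _ = δ := ENNReal.add_halves δ

lemma BddInProb.of_abs_le {V W : ℕ → Ω → ℝ} (hV : BddInProb P V) (h : ∀ n ω, |W n ω| ≤ |V n ω|) :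
    BddInProb P W := by
  intro δ hδ
  obtain ⟨M, hM⟩ := hV δ hδ
  refine ⟨M, ?_⟩
  filter_upwards [hM] with n hn
  refine (measure_mono fun ω hω h' => ?_).trans hn
  exact hω ((h n ω).trans h')

lemma bddInProb_of_whp {V : ℕ → Ω → ℝ} {M : ℝ} (h : Whp P fun n ω => |V n ω| ≤ M) :
    BddInProb P V :=
  fun δ hδ => ⟨M, ENNReal.tendsto_nhds_zero.mp h δ hδ⟩

lemma BddInProb.sub {V W : ℕ → Ω → ℝ} (hV : BddInProb P V) (hW : BddInProb P W) :
    BddInProb P fun n ω => V n ω - W n ω := by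
  simp_rw [sub_eq_add_neg]
  exact hV.add (hW.of_abs_le fun n ω => (abs_neg _).le)

lemma BddInProb.of_whp_sub {V T : ℕ → Ω → ℝ} (hV : BddInProb P V) {M : ℝ}
    (h : Whp P fun n ω => |T n ω - V n ω| ≤ M) : BddInProb P T := by
  have := (bddInProb_of_whp (V := fun n ω => T n ω - V n ω) h).add hV
  simpa using this

/-- Two sequences of random variables, one of which is bounded in probability, are asymptotically
equal as soon as their positions relative to each fixed threshold agree asymptotically. -/
lemma whp_abs_sub_le_of_thresholds {T V : ℕ → Ω → ℝ} (hV : BddInProb P V)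
    (h1 : ∀ x : ℝ, ∀ ε > 0, Whp P fun n ω => T n ω ≤ x → V n ω ≤ x + ε)
    (h2 : ∀ x : ℝ, ∀ ε > 0, Whp P fun n ω => x < T n ω → x - ε ≤ V n ω) {ε : ℝ} (hε : 0 < ε) :
    Whp P fun n ω => |T n ω - V n ω| ≤ ε := by
  set e := ε / 4 with he
  have he0 : 0 < e := by positivity
  refine ENNReal.tendsto_nhds_zero.mpr fun δ hδ => ?_
  obtain ⟨M, hM⟩ := hV (δ / 2) (ENNReal.half_pos hδ.ne')
  -- When `|V| ≤ M`, the cell `[i e, (i + 1) e)` containing `V` has an index in a fixed finite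
  -- range. The threshold `(i - 1) e` rules out `T` far below `V`, and `(i + 2) e` rules out `T` far
  -- above; the margin `3` keeps both in the grid.
  set I := Finset.Icc (-⌈M / e⌉ - 3) (⌈M / e⌉ + 3)
  have hI := (whp_forall_finset (p := fun (i : ℤ) n ω => (T n ω ≤ i * e → V n ω ≤ i * e + e / 2)) I
    fun i _ => h1 (i * e) (e / 2) (by positivity)).and
    (whp_forall_finset (p := fun (i : ℤ) n ω => (i * e < T n ω → i * e - e / 2 ≤ V n ω)) I
    fun i _ => h2 (i * e) (e / 2) (by positivity))
  filter_upwards [hM, ENNReal.tendsto_nhds_zero.mp hI _ (ENNReal.half_pos hδ.ne')] with n hn1 hn2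
  refine le_trans ((measure_mono fun ω hω => ?_).trans (measure_union_le _ _))
    ((add_le_add hn1 hn2).trans (ENNReal.add_halves δ).le)
  simp only [Set.mem_ofPred_eq, Set.mem_union] at hω ⊢
  by_contra! hcon
  obtain ⟨hb, g1, g2⟩ := hcon
  refine hω ?_
  have hlo := Int.floor_le (V n ω / e)
  have hhi := Int.lt_floor_add_one (V n ω / e)
  rw [le_div_iff₀ he0] at hlo
  rw [div_lt_iff₀ he0] at hhi
  have hb1 : V n ω / e ≤ M / e := by gcongr; exact (abs_le.mp hb).2
  have hb2 : -(M / e) ≤ V n ω / e := by rw [← neg_div]; gcongr; exact (abs_le.mp hb).1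
  have hceil := Int.le_ceil (M / e)
  have i1 : ⌊V n ω / e⌋ ≤ ⌈M / e⌉ := by
    refine Int.floor_le_iff.mpr ?_
    linarith
  have i2 : -⌈M / e⌉ ≤ ⌊V n ω / e⌋ := by
    refine Int.le_floor.mpr ?_
    push_cast
    linarith
  set i := ⌊V n ω / e⌋
  rw [abs_le]
  constructor
  · by_contra! hlt
    have := g1 (i - 1) (Finset.mem_Icc.mpr ⟨by omega, by omega⟩)
      (by push_cast; linarith)
    push_cast at this
    linarith
  · by_contra! hlt
    have := g2 (i + 2) (Finset.mem_Icc.mpr ⟨by omega, by omega⟩)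
      (by push_cast; linarith)
    push_cast at this
    linarith

end

/-! ### Order statistics and empirical quantiles -/

section OrderStatistics

/-- Duality between order statistics and counts: events about quantiles become events about sums of
indicators. -/
lemma orderStat_le_iff {n : ℕ} (x : Fin n → ℝ) {j : ℕ} (hj : 1 ≤ j ∧ j ≤ n) (t : ℝ) :
    orderStat x j ≤ t ↔ (j : ℝ) ≤ ∑ i, (Set.Iic t).indicator (fun _ => (1 : ℝ)) (x i) := by
  classical
  have h := Tuple.lt_card_le_iff_apply_le_of_monotone (j := ⟨j - 1, by omega⟩) (a := t)
    (Tuple.monotone_sort x)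
  rw [orderStat, dif_pos hj]
  have hsum : ∑ i, (Set.Iic t).indicator (fun _ => (1 : ℝ)) (x i)
      = ((Finset.univ.filter fun i => (x ∘ Tuple.sort x) i ≤ t).card : ℝ) := by
    rw [← Equiv.sum_comp (Tuple.sort x), Finset.card_filter]
    push_cast
    refine Finset.sum_congr rfl fun i _ => ?_
    simp [Set.indicator_apply]
  rw [hsum, Nat.cast_le]
  refine h.symm.trans ?_
  simp only
  omega

lemma measurable_orderStat {n : ℕ} (j : ℕ) : Measurable fun x : Fin n → ℝ => orderStat x j := by
  by_cases hj : 1 ≤ j ∧ j ≤ n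
  · refine measurable_of_Iic fun t => ?_
    have : (fun x : Fin n → ℝ => orderStat x j) ⁻¹' Set.Iic t =
        {x | (j : ℝ) ≤ ∑ i, (Set.Iic t).indicator (fun _ => (1 : ℝ)) (x i)} := by
      ext x
      exact orderStat_le_iff x hj t
    rw [this]
    refine measurableSet_le measurable_const (Finset.measurable_fun_sum _ fun i _ => ?_)
    exact (measurable_const.indicator measurableSet_Iic).comp (measurable_pi_apply i)
  · simp only [orderStat, dif_neg hj]
    exact measurable_const

lemma measurable_empQuantile {n : ℕ} (k : ℝ) :
    Measurable fun x : Fin n → ℝ => empQuantile x k := by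
  unfold empQuantile
  split_ifs
  · exact ((measurable_orderStat _).add (measurable_orderStat _)).div_const 2
  · exact measurable_orderStat _

/-- A mean of two numbers within `ε` of a target is within `ε` of it, so both cases of the
definition reduce to the two ranks. -/
lemma abs_empQuantile_sub_le {n : ℕ} (x : Fin n → ℝ) (k q v ε : ℝ)
    (h1 : |√(n : ℝ) * (orderStat x ⌈(n : ℝ) * k⌉₊ - q) - v| ≤ ε)
    (h2 : |√(n : ℝ) * (orderStat x (⌈(n : ℝ) * k⌉₊ + 1) - q) - v| ≤ ε) :
    |√(n : ℝ) * (empQuantile x k - q) - v| ≤ ε := by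
  unfold empQuantile
  split_ifs
  · rw [abs_le] at *
    constructor <;> linarith [h1.1, h1.2, h2.1, h2.2]
  · exact h1

end OrderStatistics

/-! ### The distribution function near a quantile -/

section Quantile

lemma IsDensity.hasDerivAt_cdf {ν : Measure ℝ} [IsProbabilityMeasure ν] {f : ℝ → ℝ}
    (hf : IsDensity ν f) {q : ℝ} (hq : ContinuousAt f q) : HasDerivAt (cdf ν) (f q) q := by
  have hlint : ∫⁻ x, ENNReal.ofReal (f x) = 1 := by
    have h := measure_univ (μ := ν)
    rwa [hf.eq_withDensity, withDensity_apply _ MeasurableSet.univ, Measure.restrict_univ] at h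
  have hint : Integrable f := by
    refine ⟨hf.measurable.aestronglyMeasurable, ?_⟩
    rw [hasFiniteIntegral_iff_ofReal (ae_of_all _ hf.nonneg), hlint]
    exact ENNReal.one_lt_top
  have hcdf : ∀ x, cdf ν x = (∫ y in Set.Iic q, f y) + ∫ y in q..x, f y := by
    intro x
    rw [← intervalIntegral.integral_Iic_sub_Iic hint.integrableOn hint.integrableOn,
      add_sub_cancel, cdf_eq_real, measureReal_def, hf.eq_withDensity,
      withDensity_apply _ measurableSet_Iic,
      integral_eq_lintegral_of_nonneg_ae (ae_of_all _ hf.nonneg)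
        hf.measurable.aestronglyMeasurable]
  have hd := (intervalIntegral.integral_hasDerivAt_right (a := q) (b := q)
    hint.intervalIntegrable (hf.measurable.stronglyMeasurable.stronglyMeasurableAtFilter) hq)
  exact (hd.const_add (∫ y in Set.Iic q, f y)).congr_of_eventuallyEq (Eventually.of_forall hcdf)

/-- The distribution function is below `k` to the left of the infimum and at least `k` to its right;
continuity closes the gap. -/
lemma cdf_quantile {ν : Measure ℝ} [IsProbabilityMeasure ν] {k : ℝ} (hk : 0 < k ∧ k < 1)
    (hc : ContinuousAt (cdf ν) (quantile ν k)) : cdf ν (quantile ν k) = k := by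
  set S := {x : ℝ | k ≤ cdf ν x} with hS
  have hne : S.Nonempty := by
    obtain ⟨x, hx⟩ := ((tendsto_cdf_atTop ν).eventually_const_lt hk.2).exists
    exact ⟨x, hx.le⟩
  have hbdd : BddBelow S := by
    obtain ⟨x, hx⟩ := ((tendsto_cdf_atBot ν).eventually_lt_const hk.1).exists
    refine ⟨x, fun y hy => ?_⟩
    by_contra! hlt
    exact absurd (hy.trans (monotone_cdf ν hlt.le)) (not_le.mpr hx)
  refine le_antisymm ?_ ?_
  · refine le_of_tendsto (hc.tendsto.mono_left (nhdsWithin_le_nhds (s := Set.Iio (quantile ν k)))) ?_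
    filter_upwards [self_mem_nhdsWithin] with x hx
    by_contra! hlt
    exact absurd (csInf_le hbdd hlt.le) (not_le.mpr hx)
  · refine ge_of_tendsto (hc.tendsto.mono_left (nhdsWithin_le_nhds (s := Set.Ioi (quantile ν k)))) ?_
    filter_upwards [self_mem_nhdsWithin] with x hx
    obtain ⟨y, hy, hyx⟩ := (csInf_lt_iff hbdd hne).mp hx
    exact le_trans hy (monotone_cdf ν hyx.le)

/-- A positive derivative excludes a flat piece to the right of `q`. This identifies the indicators
in the covariance of the bridge with those of `(-∞, q]`. -/
lemma cdf_le_iff_of_hasDerivAt {ν : Measure ℝ} {k d q : ℝ} (hk : cdf ν q = k) (hd : 0 < d)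
    (h : HasDerivAt (cdf ν) d q) (x : ℝ) : cdf ν x ≤ k ↔ x ≤ q := by
  refine ⟨fun hx => ?_, fun hx => hk ▸ monotone_cdf ν hx⟩
  by_contra! hlt
  have hs := (hasDerivWithinAt_iff_tendsto_slope' (s := Set.Ioi q) (by simp)).mp h.hasDerivWithinAt
  have hev : ∀ᶠ y in 𝓝[>] q, 0 < slope (cdf ν) q y := hs.eventually_const_lt hd
  obtain ⟨y, hy, hqy, hyx⟩ := (hev.and (Ioo_mem_nhdsGT hlt)).exists
  rw [slope_def_field, hk] at hy
  have h1 : cdf ν y ≤ k := (monotone_cdf ν hyx.le).trans hx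
  exact absurd hy (not_lt.mpr (div_nonpos_of_nonpos_of_nonneg (by linarith) (by linarith)))

end Quantile

/-! ### Empirical process and Bahadur representation -/

section

variable {Ω : Type*} [MeasurableSpace Ω] {P : Measure Ω} {m : ℕ} {C : ℝ}

/-- The indicator function of the half-line `(-∞, x]`. -/
noncomputable def iicInd (x : ℝ) : ℝ → ℝ := (Set.Iic x).indicator fun _ => 1

lemma measurable_iicInd (x : ℝ) : Measurable (iicInd x) :=
  measurable_const.indicator measurableSet_Iic

lemma iicInd_nonneg (x z : ℝ) : 0 ≤ iicInd x z :=
  Set.indicator_nonneg (fun _ _ => zero_le_one) z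

lemma iicInd_le_one (x z : ℝ) : iicInd x z ≤ 1 :=
  Set.indicator_le_self' (fun _ _ => zero_le_one) z

lemma iicInd_mono {x y : ℝ} (h : x ≤ y) (z : ℝ) : iicInd x z ≤ iicInd y z :=
  Set.indicator_le_indicator_of_subset (Set.Iic_subset_Iic.mpr h) (fun _ => zero_le_one) z

lemma integral_iicInd [IsProbabilityMeasure P] {U : Ω → ℝ} (hU : Measurable U) (x : ℝ) :
    ∫ ω, iicInd x (U ω) ∂P = cdf (P.map U) x := by
  have := Measure.isProbabilityMeasure_map (μ := P) hU.aemeasurable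
  rw [← integral_map hU.aemeasurable (measurable_iicInd x).aestronglyMeasurable, cdf_eq_real,
    iicInd, integral_indicator_const _ measurableSet_Iic]
  simp

lemma integrable_iicInd [IsProbabilityMeasure P] {U : Ω → ℝ} (hU : Measurable U) (x : ℝ) :
    Integrable (fun ω => iicInd x (U ω)) P :=
  Integrable.of_bound ((measurable_iicInd x).comp hU).aestronglyMeasurable 1
    (ae_of_all _ fun ω => by
      rw [Real.norm_eq_abs, abs_of_nonneg (iicInd_nonneg _ _)]; exact iicInd_le_one _ _)

/-- The empirical process `√n (Fₙ(x) - F(x))` of a sequence of random variables. -/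
noncomputable def empDeviation (P : Measure Ω) (U : ℕ → Ω → ℝ) (n : ℕ) (x : ℝ) (ω : Ω) : ℝ :=
  (√(n : ℝ))⁻¹ * ∑ i ∈ Finset.range n, (iicInd x (U i ω) - cdf (P.map (U 0)) x)

/-- Chebyshev's inequality with the linear variance bound, hence uniform in `n`. -/
lemma BoundedMDependent.measure_abs_sum_gt_le [IsProbabilityMeasure P] {ξ : ℕ → Ω → ℝ}
    (h : BoundedMDependent P m C ξ) (h0 : ∫ ω, ξ 0 ω ∂P = 0) {v : ℝ} (hv : Var[ξ 0; P] ≤ v)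
    (n : ℕ) {ε : ℝ} (hε : 0 < ε) :
    P {ω | ¬ |(√(n : ℝ))⁻¹ * ∑ i ∈ Finset.range n, ξ i ω| ≤ ε} ≤
      ENNReal.ofReal ((2 * m + 1) * v / ε ^ 2) := by
  set S := fun ω => (√(n : ℝ))⁻¹ * ∑ i ∈ Finset.range n, ξ i ω with hS
  have hmem : MemLp S 2 P := (memLp_finsetSum _ fun i _ => h.memLp i).const_mul _
  have hmean : ∫ ω, S ω ∂P = 0 := by
    rw [hS, integral_const_mul, h.integral_sum_eq_zero h0, mul_zero]
  have hv0 : 0 ≤ v := (variance_nonneg _ _).trans hv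
  have hvar : Var[S; P] ≤ (2 * m + 1) * v := by
    rw [hS, variance_const_mul, inv_pow, Real.sq_sqrt n.cast_nonneg]
    rcases Nat.eq_zero_or_pos n with rfl | hn
    · simp; positivity
    · have hn' : (0 : ℝ) < n := by exact_mod_cast hn
      have h1 := h.variance_sum_le (Finset.range n)
      rw [Finset.card_range] at h1
      calc (n : ℝ)⁻¹ * Var[fun ω => ∑ i ∈ Finset.range n, ξ i ω; P]
          ≤ (n : ℝ)⁻¹ * ((2 * m + 1) * n * v) := by
            gcongr
            exact h1.trans (by gcongr)
        _ = (2 * m + 1) * v := by field_simp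
  have hch := meas_ge_le_variance_div_sq hmem hε
  rw [hmean] at hch
  refine (measure_mono fun ω hω => ?_).trans (hch.trans (ENNReal.ofReal_le_ofReal (by gcongr)))
  simp only [Set.mem_ofPred_eq, sub_zero, not_le] at hω ⊢
  exact hω.le

/-- The hypothesis `hdep` lets both coordinates be treated alike; the bound `4` leaves ample room
for centred indicators and their differences. -/
lemma measure_abs_empDeviation_gt_le [IsProbabilityMeasure P] {U : ℕ → Ω → ℝ}
    (hU : Measurable (U 0))
    (hdep : ∀ g : ℝ → ℝ, Measurable g → (∀ z, |g z| ≤ 4) →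
      BoundedMDependent P m 4 fun i ω => g (U i ω)) (n : ℕ) (x : ℝ) {ε : ℝ} (hε : 0 < ε) :
    P {ω | ¬ |empDeviation P U n x ω| ≤ ε} ≤ ENNReal.ofReal ((2 * m + 1) / ε ^ 2) := by
  set F := cdf (P.map (U 0))
  have hξ := hdep (fun z => iicInd x z - F x) ((measurable_iicInd x).sub_const _) (fun z => by
    have := cdf_nonneg (P.map (U 0)) x
    have := cdf_le_one (P.map (U 0)) x
    have := iicInd_nonneg x z
    have := iicInd_le_one x z
    rw [abs_le]; constructor <;> linarith)
  have h0 : ∫ ω, (iicInd x (U 0 ω) - F x) ∂P = 0 := by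
    rw [integral_sub (integrable_iicInd hU x) (integrable_const _), integral_iicInd hU]
    simp [F]
  have hv : Var[fun ω => iicInd x (U 0 ω) - F x; P] ≤ 1 := by
    have hm : AEStronglyMeasurable (fun ω => iicInd x (U 0 ω)) P :=
      ((measurable_iicInd x).comp hU).aestronglyMeasurable
    rw [variance_sub_const hm]
    refine (variance_le_expectation_sq hm).trans ?_
    calc ∫ ω, ((fun ω => iicInd x (U 0 ω)) ^ 2) ω ∂P ≤ ∫ ω, (1 : ℝ) ∂P := by
          refine integral_mono_of_nonneg (ae_of_all _ fun ω => sq_nonneg _) (integrable_const _)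
            (ae_of_all _ fun ω => ?_)
          exact pow_le_one₀ (iicInd_nonneg _ _) (iicInd_le_one _ _)
      _ = 1 := by simp
  simpa [empDeviation] using hξ.measure_abs_sum_gt_le h0 hv n hε

/-- The increment sums centred indicators of `(x, y]`, whose variance is at most their mean `F y - F
x`. -/
lemma measure_abs_empDeviation_sub_gt_le [IsProbabilityMeasure P] {U : ℕ → Ω → ℝ}
    (hU : Measurable (U 0))
    (hdep : ∀ g : ℝ → ℝ, Measurable g → (∀ z, |g z| ≤ 4) →
      BoundedMDependent P m 4 fun i ω => g (U i ω)) (n : ℕ) (x y : ℝ) {ε : ℝ} (hε : 0 < ε) :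
    P {ω | ¬ |empDeviation P U n y ω - empDeviation P U n x ω| ≤ ε} ≤
      ENNReal.ofReal ((2 * m + 1) * |cdf (P.map (U 0)) y - cdf (P.map (U 0)) x| / ε ^ 2) := by
  wlog hxy : x ≤ y generalizing x y
  · have := this y x (le_of_not_ge hxy)
    rw [abs_sub_comm] at this
    simp_rw [abs_sub_comm (empDeviation P U n y _)]
    exact this
  set F := cdf (P.map (U 0))
  have hg : Measurable fun z => iicInd y z - iicInd x z :=
    (measurable_iicInd y).sub (measurable_iicInd x)
  have hξ := hdep (fun z => iicInd y z - iicInd x z - (F y - F x)) (hg.sub_const _) (fun z => by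
    have := cdf_nonneg (P.map (U 0)) x
    have := cdf_le_one (P.map (U 0)) x
    have := cdf_nonneg (P.map (U 0)) y
    have := cdf_le_one (P.map (U 0)) y
    have := iicInd_nonneg x z
    have := iicInd_le_one x z
    have := iicInd_nonneg y z
    have := iicInd_le_one y z
    rw [abs_le]; constructor <;> linarith)
  have hmean : ∫ ω, (iicInd y (U 0 ω) - iicInd x (U 0 ω)) ∂P = F y - F x := by
    rw [integral_sub (integrable_iicInd hU y) (integrable_iicInd hU x), integral_iicInd hU,
      integral_iicInd hU]
  have hint : Integrable (fun ω => iicInd y (U 0 ω) - iicInd x (U 0 ω)) P :=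
    (integrable_iicInd hU y).sub (integrable_iicInd hU x)
  have h0 : ∫ ω, (iicInd y (U 0 ω) - iicInd x (U 0 ω) - (F y - F x)) ∂P = 0 := by
    rw [integral_sub hint (integrable_const _), hmean]
    simp
  have hv : Var[fun ω => iicInd y (U 0 ω) - iicInd x (U 0 ω) - (F y - F x); P] ≤ |F y - F x| := by
    have hm : AEStronglyMeasurable (fun ω => iicInd y (U 0 ω) - iicInd x (U 0 ω)) P :=
      (hg.comp hU).aestronglyMeasurable
    rw [variance_sub_const hm]
    refine (variance_le_expectation_sq hm).trans ?_
    rw [abs_of_nonneg (sub_nonneg.mpr (monotone_cdf _ hxy)), ← hmean]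
    refine integral_mono_of_nonneg (ae_of_all _ fun ω => sq_nonneg _) hint
      (ae_of_all _ fun ω => ?_)
    have h1 := iicInd_mono hxy (U 0 ω)
    have h2 := iicInd_le_one y (U 0 ω)
    have h3 := iicInd_nonneg x (U 0 ω)
    exact pow_le_of_le_one (by simp only; linarith) (by simp only; linarith) two_ne_zero
  have := hξ.measure_abs_sum_gt_le h0 hv n hε
  refine le_trans (le_of_eq ?_) this
  congr 1
  ext ω
  simp only [empDeviation, ← mul_sub, ← Finset.sum_sub_distrib, Set.mem_ofPred_eq]
  have e : ∀ i, iicInd y (U i ω) - cdf (P.map (U 0)) y - (iicInd x (U i ω) - cdf (P.map (U 0)) x)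
      = iicInd y (U i ω) - iicInd x (U i ω) - (F y - F x) := fun i => by simp only [F]; ring
  simp_rw [e]

lemma bddInProb_empDeviation [IsProbabilityMeasure P] {U : ℕ → Ω → ℝ}
    (hU : Measurable (U 0))
    (hdep : ∀ g : ℝ → ℝ, Measurable g → (∀ z, |g z| ≤ 4) →
      BoundedMDependent P m 4 fun i ω => g (U i ω)) (x : ℝ) :
    BddInProb P fun n => empDeviation P U n x := by
  intro δ hδ
  have hlim : Tendsto (fun M : ℝ => ENNReal.ofReal ((2 * m + 1) / M ^ 2)) atTop (𝓝 0) := by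
    have : Tendsto (fun M : ℝ => (2 * (m : ℝ) + 1) / M ^ 2) atTop (𝓝 0) :=
      tendsto_const_nhds.div_atTop (tendsto_pow_atTop two_ne_zero)
    simpa using ENNReal.tendsto_ofReal this
  obtain ⟨M, hM, hM0⟩ :=
    ((ENNReal.tendsto_nhds_zero.mp hlim δ hδ).and (eventually_gt_atTop 0)).exists
  exact ⟨M, Eventually.of_forall fun n =>
    (measure_abs_empDeviation_gt_le hU hdep n x hM0).trans hM⟩

lemma bddInProb_neg_empDeviation_div [IsProbabilityMeasure P] {U : ℕ → Ω → ℝ}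
    (hU : Measurable (U 0))
    (hdep : ∀ g : ℝ → ℝ, Measurable g → (∀ z, |g z| ≤ 4) →
      BoundedMDependent P m 4 fun i ω => g (U i ω)) {d : ℝ} (hd : 0 < d) (x : ℝ) :
    BddInProb P fun n ω => -(empDeviation P U n x ω / d) := by
  intro δ hδ
  obtain ⟨M, hM⟩ := bddInProb_empDeviation hU hdep x δ hδ
  refine ⟨M / d, ?_⟩
  filter_upwards [hM] with n hn
  refine (measure_mono fun ω hω h' => ?_).trans hn
  refine hω ?_
  rw [abs_neg, abs_div, abs_of_pos hd]
  gcongr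

lemma tendsto_sqrt_natCast_atTop : Tendsto (fun n : ℕ => √(n : ℝ)) atTop atTop :=
  Real.tendsto_sqrt_atTop.comp tendsto_natCast_atTop_atTop

lemma whp_abs_empDeviation_sub_le [IsProbabilityMeasure P] {U : ℕ → Ω → ℝ}
    (hU : Measurable (U 0))
    (hdep : ∀ g : ℝ → ℝ, Measurable g → (∀ z, |g z| ≤ 4) →
      BoundedMDependent P m 4 fun i ω => g (U i ω)) {q : ℝ}
    (hc : ContinuousAt (cdf (P.map (U 0))) q) {y : ℕ → ℝ} (hy : Tendsto y atTop (𝓝 q))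
    {ε : ℝ} (hε : 0 < ε) :
    Whp P fun n ω => |empDeviation P U n (y n) ω - empDeviation P U n q ω| ≤ ε := by
  have h1 : Tendsto (fun n => (2 * (m : ℝ) + 1) *
      |cdf (P.map (U 0)) (y n) - cdf (P.map (U 0)) q| / ε ^ 2) atTop (𝓝 0) := by
    have h2 := (hc.tendsto.comp hy).sub_const (cdf (P.map (U 0)) q)
    have h3 := (h2.abs.const_mul (2 * (m : ℝ) + 1)).div_const (ε ^ 2)
    simpa using h3
  have h4 : Tendsto (fun n => ENNReal.ofReal ((2 * (m : ℝ) + 1) *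
      |cdf (P.map (U 0)) (y n) - cdf (P.map (U 0)) q| / ε ^ 2)) atTop (𝓝 0) := by
    simpa using ENNReal.tendsto_ofReal h1
  exact tendsto_of_tendsto_of_tendsto_of_le_of_le tendsto_const_nhds h4 (fun _ => zero_le)
    fun n => measure_abs_empDeviation_sub_gt_le hU hdep n q (y n) hε

lemma orderStat_le_iff_empDeviation {U : ℕ → Ω → ℝ} {n j : ℕ} (hj : 1 ≤ j ∧ j ≤ n) (x : ℝ) (ω : Ω) :
    orderStat (fun i : Fin n => U i ω) j ≤ x ↔
      (√(n : ℝ))⁻¹ * (j - n * cdf (P.map (U 0)) x) ≤ empDeviation P U n x ω := by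
  have hn : (0 : ℝ) < n := by exact_mod_cast (by omega : 0 < n)
  have hs : 0 < (√(n : ℝ))⁻¹ := inv_pos.mpr (Real.sqrt_pos.mpr hn)
  rw [orderStat_le_iff _ hj, empDeviation, mul_le_mul_iff_right₀ hs, Finset.sum_sub_distrib,
    Finset.sum_const, Finset.card_range, nsmul_eq_mul, sub_le_sub_iff_right,
    Fin.sum_univ_eq_sum_range (fun i => (Set.Iic x).indicator (fun _ => (1 : ℝ)) (U i ω)) n]
  rfl

/-- The **Bahadur representation** of the order statistics of rank `n k + o(√n)`. -/
theorem whp_abs_orderStat_sub_le [IsProbabilityMeasure P] {U : ℕ → Ω → ℝ}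
    (hU : Measurable (U 0))
    (hdep : ∀ g : ℝ → ℝ, Measurable g → (∀ z, |g z| ≤ 4) →
      BoundedMDependent P m 4 fun i ω => g (U i ω)) {k q d : ℝ}
    (hk : cdf (P.map (U 0)) q = k) (hd : 0 < d) (hderiv : HasDerivAt (cdf (P.map (U 0))) d q)
    {j : ℕ → ℕ} (hj : ∀ᶠ n in atTop, 1 ≤ j n ∧ j n ≤ n)
    (hjk : Tendsto (fun n : ℕ => (√(n : ℝ))⁻¹ * (j n - n * k)) atTop (𝓝 0))
    {ε : ℝ} (hε : 0 < ε) :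
    Whp P fun n ω => |√(n : ℝ) * (orderStat (fun i : Fin n => U i ω) (j n) - q)
      - -(empDeviation P U n q ω / d)| ≤ ε := by
  set F := cdf (P.map (U 0))
  have hs := tendsto_sqrt_natCast_atTop
  have hy : ∀ x : ℝ, Tendsto (fun n : ℕ => q + (√(n : ℝ))⁻¹ * x) atTop (𝓝 q) := fun x => by
    simpa using ((tendsto_inv_atTop_zero.comp hs).mul_const x).const_add q
  -- The rank error vanishes by `hjk`, and `√n (F(q + x/√n) - F(q)) → d x` by differentiability.
  have hc : ∀ x : ℝ, Tendsto (fun n : ℕ =>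
      (√(n : ℝ))⁻¹ * (j n - n * F (q + (√(n : ℝ))⁻¹ * x))) atTop (𝓝 (-(d * x))) := by
    intro x
    have h1 := hderiv.hasFDerivAt.lim (c := fun n : ℕ => √(n : ℝ)) x (l := atTop)
      (by simpa [abs_of_nonneg] using! hs)
    have h2 := hjk.sub h1
    simp only [smul_eq_mul, ContinuousLinearMap.toSpanSingleton_apply, zero_sub, hk] at h2
    rw [mul_comm d x]
    refine h2.congr' ?_
    filter_upwards [eventually_gt_atTop 0] with n hn
    have hn' : (0 : ℝ) < n := by exact_mod_cast hn
    have hsq : √(n : ℝ) * √(n : ℝ) = n := Real.mul_self_sqrt hn'.le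
    have hs0 : √(n : ℝ) ≠ 0 := (Real.sqrt_pos.mpr hn').ne'
    field_simp
    rw [show √(n : ℝ) ^ 2 = n by rw [sq, hsq]]
    ring
  -- Together these say that, up to small errors, the order statistic is below the threshold `x`
  -- exactly when `E_n(q) ≥ -d x`.
  have hcond : ∀ x : ℝ, ∀ e > 0, Whp P fun n ω =>
      ((√(n : ℝ) * (orderStat (fun i : Fin n => U i ω) (j n) - q) ≤ x ↔
        (√(n : ℝ))⁻¹ * (j n - n * F (q + (√(n : ℝ))⁻¹ * x)) ≤
          empDeviation P U n (q + (√(n : ℝ))⁻¹ * x) ω) ∧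
      |(√(n : ℝ))⁻¹ * (j n - n * F (q + (√(n : ℝ))⁻¹ * x)) - -(d * x)| ≤ e) ∧
      |empDeviation P U n (q + (√(n : ℝ))⁻¹ * x) ω - empDeviation P U n q ω| ≤ e := by
    intro x e he
    refine Whp.and (whp_of_eventually ?_)
      (whp_abs_empDeviation_sub_le hU hdep hderiv.continuousAt (hy x) he)
    filter_upwards [hj, Metric.tendsto_nhds.mp (hc x) e he] with n hjn hn ω
    refine ⟨?_, by rw [Real.dist_eq] at hn; exact hn.le⟩
    rw [← orderStat_le_iff_empDeviation hjn]
    have hn' : (0 : ℝ) < n := by exact_mod_cast (by omega : 0 < n)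
    rw [← le_div_iff₀' (Real.sqrt_pos.mpr hn'), sub_le_iff_le_add', div_eq_inv_mul]
  have hV := bddInProb_neg_empDeviation_div hU hdep hd q
  refine whp_abs_sub_le_of_thresholds hV ?_ ?_ hε
  · intro x e he
    -- Two errors of `d e / 2` add up to `d e`, which becomes `e` after division by `d`.
    refine (hcond x (d * e / 2) (by positivity)).mono (Eventually.of_forall ?_)
    rintro n ω ⟨⟨h1, h2⟩, h3⟩ hT
    have h4 := h1.mp hT
    rw [abs_le] at h2 h3
    rw [← neg_div, div_le_iff₀ hd]
    nlinarith [h2.1, h2.2, h3.1, h3.2]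
  · intro x e he
    refine (hcond x (d * e / 2) (by positivity)).mono (Eventually.of_forall ?_)
    rintro n ω ⟨⟨h1, h2⟩, h3⟩ hT
    have h4 := not_le.mp (mt h1.mpr (not_le.mpr hT))
    rw [abs_le] at h2 h3
    rw [← neg_div, le_div_iff₀ hd]
    nlinarith [h2.1, h2.2, h3.1, h3.2]

/-- The **Bahadur representation** of the empirical quantiles. -/
theorem whp_abs_empQuantile_sub_le [IsProbabilityMeasure P] {U : ℕ → Ω → ℝ}
    (hU : Measurable (U 0))
    (hdep : ∀ g : ℝ → ℝ, Measurable g → (∀ z, |g z| ≤ 4) →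
      BoundedMDependent P m 4 fun i ω => g (U i ω)) {k q d : ℝ} (hk01 : 0 < k ∧ k < 1)
    (hk : cdf (P.map (U 0)) q = k) (hd : 0 < d) (hderiv : HasDerivAt (cdf (P.map (U 0))) d q)
    {ε : ℝ} (hε : 0 < ε) :
    Whp P fun n ω => |√(n : ℝ) * (empQuantile (fun i : Fin n => U i ω) k - q)
      - -(empDeviation P U n q ω / d)| ≤ ε := by
  -- This gives `⌈n k⌉ + 1 < n k + 2 ≤ n`, so neither rank meets the default value of `orderStat`.
  have hlarge : ∀ᶠ n : ℕ in atTop, 2 ≤ (n : ℝ) * (1 - k) :=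
    (tendsto_natCast_atTop_atTop.atTop_mul_const (by linarith [hk01.2])).eventually_ge_atTop 2
  have hceil : ∀ n : ℕ, (n : ℝ) * k ≤ ⌈(n : ℝ) * k⌉₊ ∧ (⌈(n : ℝ) * k⌉₊ : ℝ) < n * k + 1 := fun n =>
    ⟨Nat.le_ceil _, Nat.ceil_lt_add_one (mul_nonneg n.cast_nonneg hk01.1.le)⟩
  have hpos : ∀ᶠ n : ℕ in atTop, 1 ≤ ⌈(n : ℝ) * k⌉₊ := by
    filter_upwards [eventually_gt_atTop 0] with n hn
    have : (0 : ℝ) < n := by exact_mod_cast hn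
    exact Nat.one_le_ceil_iff.mpr (mul_pos this hk01.1)
  have hlim : ∀ j : ℕ → ℕ, (∀ n : ℕ, (n : ℝ) * k ≤ j n ∧ (j n : ℝ) ≤ n * k + 2) →
      Tendsto (fun n : ℕ => (√(n : ℝ))⁻¹ * (j n - n * k)) atTop (𝓝 0) := by
    intro j hj
    have h0 : Tendsto (fun n : ℕ => (√(n : ℝ))⁻¹ * 2) atTop (𝓝 0) := by
      simpa using (tendsto_inv_atTop_zero.comp tendsto_sqrt_natCast_atTop).mul_const (2 : ℝ)
    refine squeeze_zero (fun n => mul_nonneg (by positivity) (by linarith [(hj n).1]))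
      (fun n => ?_) h0
    exact mul_le_mul_of_nonneg_left (by linarith [(hj n).2]) (by positivity)
  have h1 := whp_abs_orderStat_sub_le hU hdep hk hd hderiv (j := fun n => ⌈(n : ℝ) * k⌉₊)
    (by
      filter_upwards [hlarge, hpos] with n hn hp
      refine ⟨hp, ?_⟩
      have : (⌈(n : ℝ) * k⌉₊ : ℝ) ≤ n := by linarith [(hceil n).2]
      exact_mod_cast this)
    (hlim _ fun n => ⟨(hceil n).1, by linarith [(hceil n).2]⟩) hε
  have h2 := whp_abs_orderStat_sub_le hU hdep hk hd hderiv (j := fun n => ⌈(n : ℝ) * k⌉₊ + 1)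
    (by
      filter_upwards [hlarge] with n hn
      refine ⟨by omega, ?_⟩
      have : ((⌈(n : ℝ) * k⌉₊ + 1 : ℕ) : ℝ) ≤ n := by push_cast; linarith [(hceil n).2]
      exact_mod_cast this)
    (hlim _ fun n => by
      push_cast
      exact ⟨by linarith [(hceil n).1], by linarith [(hceil n).2]⟩) hε
  exact (h1.and h2).mono (Eventually.of_forall fun n ω h =>
    abs_empQuantile_sub_le _ _ _ _ _ h.1 h.2)

end

/-! ### Multivariate central limit theorem -/

section MultivariateCLT

variable {Ω Ω' : Type*} [MeasurableSpace Ω] [MeasurableSpace Ω'] {P : Measure Ω}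
  {P' : Measure Ω'} {m : ℕ}

lemma longRunCov_comm (P : Measure Ω) (m : ℕ) (U V : ℕ → Ω → ℝ) :
    longRunCov P m U V = longRunCov P m V U := by
  rw [longRunCov, longRunCov, covariance_comm]
  congr 1
  refine Finset.sum_congr rfl fun h _ => ?_
  rw [covariance_comm (U 0), covariance_comm (U h), add_comm]

/-- Bilinearity; it matches the limit variance of a linear combination of the data with that of the
same combination of the Gaussian limit. -/
lemma longRunCov_sum_const_mul_sub {ι : Type*} [Fintype ι] [IsProbabilityMeasure P]
    {V : ι → ℕ → Ω → ℝ} (hV : ∀ j i, MemLp (V j i) 2 P) (a c : ι → ℝ) :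
    longRunCov P m (fun i ω => ∑ j, a j * (V j i ω - c j))
      (fun i ω => ∑ j, a j * (V j i ω - c j)) =
      ∑ j, ∑ l, a j * a l * longRunCov P m (V j) (V l) := by
  have hint : ∀ j i, Integrable (V j i) P := fun j i => (hV j i).integrable (by norm_num)
  have hmem : ∀ i j, MemLp (fun ω => a j * (V j i ω - c j)) 2 P :=
    fun i j => ((hV j i).sub (memLp_const _)).const_mul _
  have key : ∀ s t, cov[fun ω => ∑ j, a j * (V j s ω - c j),
      fun ω => ∑ j, a j * (V j t ω - c j); P] = ∑ j, ∑ l, a j * a l * cov[V j s, V l t; P] := by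
    intro s t
    rw [covariance_fun_sum_fun_sum (hmem s) (hmem t)]
    refine Finset.sum_congr rfl fun j _ => Finset.sum_congr rfl fun l _ => ?_
    rw [covariance_const_mul_left, covariance_const_mul_right,
      covariance_sub_const_left (hint j s), covariance_sub_const_right (hint l t)]
    ring
  simp only [longRunCov, key, mul_add, Finset.mul_sum, Finset.sum_add_distrib]
  congr 1
  congr 1 <;>
  · rw [Finset.sum_comm]
    refine Finset.sum_congr rfl fun j _ => ?_
    rw [Finset.sum_comm]

/-- The multivariate **central limit theorem** for bounded functionals of a stationary
`m`-dependent sequence. -/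
theorem tendstoInDistribution_multivariate [IsProbabilityMeasure P] [IsProbabilityMeasure P']
    {ι : Type*} [Fintype ι] {X Y : ℕ → Ω → ℝ}
    (hX : ∀ i, Measurable (X i)) (hY : ∀ i, Measurable (Y i)) (hstat : StrictlyStationary P X Y)
    (hdep : MDependent P X Y m) {g : ι → ℝ × ℝ → ℝ} (hg : ∀ j, Measurable (g j))
    (hg1 : ∀ j z, |g j z| ≤ 1) {N : ι → Ω' → ℝ} (hN : IsGaussianProcess N P')
    (hmean : ∀ j, ∫ ω, N j ω ∂P' = 0)
    (hcov : ∀ j l, cov[N j, N l; P'] = longRunCov P m (fun i ω => g j (X i ω, Y i ω))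
      (fun i ω => g l (X i ω, Y i ω))) :
    TendstoInDistribution (fun (n : ℕ) ω => WithLp.toLp 2 fun j => (√(n : ℝ))⁻¹ *
      ∑ i ∈ Finset.range n, (g j (X i ω, Y i ω) - ∫ ω', g j (X 0 ω', Y 0 ω') ∂P)) atTop
      (fun ω => (WithLp.toLp 2 fun j => N j ω : EuclideanSpace ℝ ι)) (fun _ => P) P' := by
  set V : ι → ℕ → Ω → ℝ := fun j i ω => g j (X i ω, Y i ω)
  set c : ι → ℝ := fun j => ∫ ω, V j 0 ω ∂P
  have hVm : ∀ j i, Measurable (V j i) := fun j i => (hg j).comp ((hX i).prodMk (hY i))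
  have hVL : ∀ j i, MemLp (V j i) 2 P := fun j i =>
    MemLp.of_bound (hVm j i).aestronglyMeasurable 1 (ae_of_all _ fun ω => hg1 _ _)
  have hWm : ∀ n : ℕ, Measurable fun ω => (WithLp.toLp 2 fun j => (√(n : ℝ))⁻¹ *
      ∑ i ∈ Finset.range n, (V j i ω - c j) : EuclideanSpace ℝ ι) := by
    intro n
    refine (WithLp.measurable_toLp 2 _).comp (measurable_pi_lambda _ fun j => ?_)
    exact (Finset.measurable_fun_sum _ fun i _ => (hVm j i).sub_const _).const_mul _
  have hNlaw : HasGaussianLaw (fun ω => (WithLp.toLp 2 fun j => N j ω : EuclideanSpace ℝ ι)) P' := by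
    have h1 : HasGaussianLaw (fun ω j => N j ω) P' :=
      (hN.hasGaussianLaw Finset.univ).map (ContinuousLinearMap.pi
        (fun j => ContinuousLinearMap.proj (R := ℝ) (φ := fun _ : (Finset.univ : Finset ι) => ℝ)
          ⟨j, Finset.mem_univ j⟩))
    exact h1.toLp_pi 2
  refine ⟨fun n => (hWm n).aemeasurable, hNlaw.aemeasurable, ?_⟩
  refine ProbabilityMeasure.tendsto_iff_tendsto_charFun.mpr fun a => ?_
  simp only [ProbabilityMeasure.coe_mk]
  set ξ : ℕ → Ω → ℝ := fun i ω => ∑ j, a j * (V j i ω - c j)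
  have hc1 : ∀ j, |c j| ≤ 1 := fun j => by
    have := norm_integral_le_of_norm_le_const (μ := P) (f := V j 0) (C := 1)
      (ae_of_all P fun ω => hg1 j (X 0 ω, Y 0 ω))
    simpa using this
  have hξ : BoundedMDependent P m (∑ j, |a j| * 2) ξ := by
    refine BoundedMDependent.of_comp hX hY hstat hdep (g := fun z => ∑ j, a j * (g j z - c j))
      (Finset.measurable_fun_sum _ fun j _ => ((hg j).sub_const _).const_mul _) fun z => ?_
    refine (Finset.abs_sum_le_sum_abs _ _).trans (Finset.sum_le_sum fun j _ => ?_)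
    rw [abs_mul]
    gcongr
    exact (abs_sub _ _).trans (by linarith [hg1 j z, hc1 j])
  have h0 : ∫ ω, ξ 0 ω ∂P = 0 := by
    have hint : ∀ j, Integrable (V j 0) P := fun j => (hVL j 0).integrable (by norm_num)
    have hint' : ∀ j ∈ Finset.univ, Integrable (fun ω => a j * (V j 0 ω - c j)) P :=
      fun j _ => ((hint j).sub (integrable_const _)).const_mul _
    simp only [ξ]
    rw [integral_finsetSum _ hint']
    refine Finset.sum_eq_zero fun j _ => ?_
    rw [integral_const_mul, integral_sub (hint j) (integrable_const _)]
    simp [c]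
  -- Cramér–Wold: the characteristic function of the vector at `a` is that of its scalar projection
  -- along `a` at `1`.
  have clt := hξ.tendsto_charFun h0 1
  have hlim : charFun (P'.map fun ω => (WithLp.toLp 2 fun j => N j ω : EuclideanSpace ℝ ι)) a
      = Complex.exp (-((longRunCov P m ξ ξ : ℝ) * ((1 : ℝ) : ℂ) ^ 2 / 2)) := by
    have hNL : ∀ j, MemLp (fun ω => a j * N j ω) 2 P' :=
      fun j => (hN.hasGaussianLaw_eval j).memLp_two.const_mul _
    have hinner : ∀ ω, inner ℝ a (WithLp.toLp 2 fun j => N j ω : EuclideanSpace ℝ ι) =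
        ∑ j, a j * N j ω := fun ω => by
      simp [PiLp.inner_apply, mul_comm]
    rw [hNlaw.charFun_map_eq a]
    simp_rw [hinner]
    rw [integral_finsetSum _ fun j _ => (hNL j).integrable (by norm_num), variance_fun_sum hNL,
      longRunCov_sum_const_mul_sub hVL]
    simp_rw [integral_const_mul, hmean, covariance_const_mul_left, covariance_const_mul_right, hcov]
    congr 1
    simp only [mul_zero, Finset.sum_const_zero, Complex.ofReal_zero, zero_mul, zero_sub,
      Complex.ofReal_one, one_pow, mul_one]
    congr 4
    funext j
    refine Finset.sum_congr rfl fun l _ => ?_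
    simp only [V]
    ring
  rw [hlim]
  refine clt.congr fun n => ?_
  have hSm : AEMeasurable (fun ω => (√(n : ℝ))⁻¹ * ∑ i ∈ Finset.range n, ξ i ω) P :=
    ((Finset.measurable_fun_sum _ fun i _ => hξ.measurable i).const_mul _).aemeasurable
  rw [charFun_apply_real, charFun_apply, integral_map hSm (by fun_prop),
    integral_map (hWm n).aemeasurable (by fun_prop)]
  refine integral_congr_ae (ae_of_all _ fun ω => ?_)
  simp only [ξ, PiLp.inner_apply, Complex.ofReal_one, one_mul]
  congr 3
  rw [Finset.sum_comm, Finset.mul_sum]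
  refine Finset.sum_congr rfl fun j _ => ?_
  rw [← Finset.mul_sum]
  simp
  ring

end MultivariateCLT

/-! ### Linearisation of the absolute difference at each level -/

section Levels

variable {Ω : Type*} [MeasurableSpace Ω] {P : Measure Ω}

/-- A perturbation of size at most `|δ|` cannot push `δ` across zero, so the linearisation is exact.
-/
lemma abs_add_of_abs_le {δ u : ℝ} (h : |u| ≤ |δ|) : |δ + u| = |δ| + Real.sign δ * u := by
  rcases lt_trichotomy δ 0 with hδ | rfl | hδ
  · rw [Real.sign_of_neg hδ, abs_of_neg hδ] at *
    rw [abs_of_nonpos (by linarith [(abs_le.mp h).2])]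
    ring
  · simp_all
  · rw [Real.sign_of_pos hδ, abs_of_pos hδ] at *
    rw [abs_of_nonneg (by linarith [(abs_le.mp h).1])]
    ring

lemma abs_sign_mul_le (δ u : ℝ) : |Real.sign δ * u| ≤ |u| := by
  rcases Real.sign_apply_eq δ with h | h | h <;> simp [h]

variable {x y V W : ℕ → Ω → ℝ} {q r Δ : ℝ}

lemma bddInProb_sqrt_mul_sub (hV : BddInProb P V)
    (hx : ∀ ε > 0, Whp P fun n ω => |√(n : ℝ) * (x n ω - q) - V n ω| ≤ ε) :
    BddInProb P fun n ω => √(n : ℝ) * (x n ω - q) :=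
  hV.of_whp_sub (hx 1 one_pos)

/-- As `√n Δ → ∞`, the tight rescaled errors are eventually smaller than `√n |q - r|`, so the exact
linearisation applies. This is where `Δ > 0` matters. -/
lemma whp_boundary_level (hV : BddInProb P V) (hW : BddInProb P W)
    (hx : ∀ ε > 0, Whp P fun n ω => |√(n : ℝ) * (x n ω - q) - V n ω| ≤ ε)
    (hy : ∀ ε > 0, Whp P fun n ω => |√(n : ℝ) * (y n ω - r) - W n ω| ≤ ε)
    (hΔ : 0 < Δ) (hqr : |q - r| = Δ) {ε : ℝ} (hε : 0 < ε) :
    Whp P fun n ω => |√(n : ℝ) * (|x n ω - y n ω| - Δ) -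
      Real.sign (q - r) * (V n ω - W n ω)| ≤ ε := by
  have hb := (bddInProb_sqrt_mul_sub hV hx).sub (bddInProb_sqrt_mul_sub hW hy)
  have hlim : Tendsto (fun n : ℕ => √(n : ℝ) * Δ) atTop atTop :=
    tendsto_sqrt_natCast_atTop.atTop_mul_const hΔ
  refine ((hb.whp hlim).and ((hx (ε / 2) (by positivity)).and (hy (ε / 2) (by positivity)))).mono ?_
  filter_upwards [eventually_gt_atTop 0] with n hn ω ⟨h1, h2, h3⟩
  have hs : 0 < √(n : ℝ) := Real.sqrt_pos.mpr (by exact_mod_cast hn)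
  have h4 : |(x n ω - q) - (y n ω - r)| ≤ |q - r| := by
    rw [← mul_sub, abs_mul, abs_of_pos hs] at h1
    rw [hqr]
    exact le_of_mul_le_mul_left h1 hs
  have h5 := abs_add_of_abs_le h4
  rw [show q - r + (x n ω - q - (y n ω - r)) = x n ω - y n ω by ring, hqr] at h5
  rw [h5]
  have h6 : √(n : ℝ) * (Δ + Real.sign (q - r) * (x n ω - q - (y n ω - r)) - Δ) -
      Real.sign (q - r) * (V n ω - W n ω) = Real.sign (q - r) *
      ((√(n : ℝ) * (x n ω - q) - V n ω) - (√(n : ℝ) * (y n ω - r) - W n ω)) := by ring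
  rw [h6]
  refine (abs_sign_mul_le _ _).trans ((abs_sub _ _).trans ?_)
  linarith

/-- The gap is of order `√n`, and the tight fluctuations consume at most half of it. -/
lemma whp_interior_level (hV : BddInProb P V) (hW : BddInProb P W)
    (hx : ∀ ε > 0, Whp P fun n ω => |√(n : ℝ) * (x n ω - q) - V n ω| ≤ ε)
    (hy : ∀ ε > 0, Whp P fun n ω => |√(n : ℝ) * (y n ω - r) - W n ω| ≤ ε)
    (hqr : |q - r| < Δ) :
    Whp P fun n ω => √(n : ℝ) * (|x n ω - y n ω| - Δ) ≤ -(√(n : ℝ) * ((Δ - |q - r|) / 2)) := by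
  have hb := (bddInProb_sqrt_mul_sub hV hx).sub (bddInProb_sqrt_mul_sub hW hy)
  have hlim : Tendsto (fun n : ℕ => √(n : ℝ) * ((Δ - |q - r|) / 2)) atTop atTop :=
    tendsto_sqrt_natCast_atTop.atTop_mul_const (by linarith)
  refine (hb.whp hlim).mono (Eventually.of_forall fun n ω h1 => ?_)
  have hs : 0 ≤ √(n : ℝ) := Real.sqrt_nonneg _
  rw [← mul_sub, abs_mul, abs_of_nonneg hs] at h1
  have h2 : |x n ω - y n ω| ≤ |q - r| + |(x n ω - q) - (y n ω - r)| := by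
    have := abs_add_le (q - r) ((x n ω - q) - (y n ω - r))
    rwa [show q - r + (x n ω - q - (y n ω - r)) = x n ω - y n ω by ring] at this
  have h3 := mul_le_mul_of_nonneg_left h2 hs
  linarith

end Levels

/-! ### The maximum over the levels and the limit in `EReal` -/

section

variable {Ω Ω' : Type*} [MeasurableSpace Ω] [MeasurableSpace Ω'] {P : Measure Ω}
  {P' : Measure Ω'} {m : ℕ}

lemma tendstoInMeasure_zero_of_whp {A : ℕ → Ω → ℝ}
    (h : ∀ ε > 0, Whp P fun n ω => |A n ω| ≤ ε) : TendstoInMeasure P A atTop 0 := by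
  rw [tendstoInMeasure_iff_norm]
  intro ε hε
  refine tendsto_of_tendsto_of_tendsto_of_le_of_le tendsto_const_nhds (h (ε / 2) (by positivity))
    (fun _ => zero_le) fun n => measure_mono fun ω hω => ?_
  simp only [Set.mem_ofPred_eq, Pi.zero_apply, sub_zero, Real.norm_eq_abs, not_le] at hω ⊢
  linarith

/-- Real random variables which tend to `-∞` in probability converge weakly to `⊥` in `EReal`. -/
lemma tendstoInDistribution_bot_of_whp [IsProbabilityMeasure P] [IsProbabilityMeasure P']
    {S : ℕ → Ω → ℝ} (hS : ∀ n, Measurable (S n)) (h : ∀ M : ℝ, Whp P fun n ω => S n ω ≤ M) :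
    TendstoInDistribution (fun n ω => (S n ω : EReal)) atTop (fun _ => (⊥ : EReal))
      (fun _ => P) P' := by
  -- The exponential turns divergence to `-∞` into convergence to `0` in `ℝ`; the extended
  -- logarithm, continuous with value `⊥` at `0`, carries it back.
  have h1 : TendstoInMeasure P (fun n ω => Real.exp (S n ω)) atTop 0 := by
    refine tendstoInMeasure_zero_of_whp fun ε hε => ?_
    refine (h (Real.log ε)).mono (Eventually.of_forall fun n ω hω => ?_)
    rw [abs_of_pos (Real.exp_pos _)]
    exact (Real.le_log_iff_exp_le hε).mp hω
  have h2 : TendstoInDistribution (fun n ω => Real.exp (S n ω)) atTop (fun _ : Ω' => (0 : ℝ))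
      (fun _ => P) P' := by
    refine tendstoInDistribution_of_tendstoInMeasure_sub (X := fun _ _ => 0) _ _ ?_ ?_
      fun n => ((hS n).exp).aemeasurable
    · exact tendstoInDistribution_of_identDistrib 0
        (fun _ => ⟨aemeasurable_const, aemeasurable_const, rfl⟩)
        ⟨aemeasurable_const, aemeasurable_const, by simp⟩
    · convert h1 using 1
      ext n ω
      simp
  have h3 := h2.continuous_comp (g := fun x => ENNReal.log (ENNReal.ofReal x))
    (ENNReal.continuous_log.comp ENNReal.continuous_ofReal)
  convert h3 using 1
  · funext n ω
    rw [Function.comp, ENNReal.log_ofReal_of_pos (Real.exp_pos _), Real.log_exp]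
  · funext ω
    simp

lemma levelInd_eq_iicInd {U : ℕ → Ω → ℝ} {k q d : ℝ} (hk : cdf (P.map (U 0)) q = k) (hd : 0 < d)
    (h : HasDerivAt (cdf (P.map (U 0))) d q) :
    levelInd P U k = fun i ω => iicInd q (U i ω) := by
  funext i ω
  simp only [levelInd, iicInd, Set.indicator_apply, Set.mem_ofPred_eq, Set.mem_Iic,
    cdf_le_iff_of_hasDerivAt hk hd h]

lemma measurable_maxStat (K : Finset ℝ) (hK : K.Nonempty) (Δ : ℝ) (n : ℕ)
    {X Y : ℕ → Ω → ℝ} (hX : ∀ i, Measurable (X i)) (hY : ∀ i, Measurable (Y i)) :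
    Measurable fun ω => maxStat K hK Δ (fun i : Fin n => X i ω) (fun i : Fin n => Y i ω) := by
  unfold maxStat
  refine Measurable.const_mul ?_ _
  have : ∀ k ∈ K, Measurable fun ω => |empQuantile (fun i : Fin n => X i ω) k -
      empQuantile (fun i : Fin n => Y i ω) k| - Δ := fun k _ => by
    have h1 := (measurable_empQuantile (n := n) k).comp
      (measurable_pi_lambda (fun ω (i : Fin n) => X i ω) fun i => hX i)
    have h2 := (measurable_empQuantile (n := n) k).comp
      (measurable_pi_lambda (fun ω (i : Fin n) => Y i ω) fun i => hY i)
    have h3 := (h1.sub h2).norm.sub_const Δ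
    exact h3
  convert Finset.measurable_sup' hK this using 1
  funext ω
  rw [Finset.sup'_apply]

lemma le_maxStat {K : Finset ℝ} (hK : K.Nonempty) (Δ : ℝ) {n : ℕ} (x y : Fin n → ℝ) {k : ℝ}
    (hk : k ∈ K) :
    √(n : ℝ) * (|empQuantile x k - empQuantile y k| - Δ) ≤ maxStat K hK Δ x y :=
  mul_le_mul_of_nonneg_left
    (Finset.le_sup' (fun k => |empQuantile x k - empQuantile y k| - Δ) hk) (Real.sqrt_nonneg _)

lemma exists_maxStat_eq {K : Finset ℝ} (hK : K.Nonempty) (Δ : ℝ) {n : ℕ} (x y : Fin n → ℝ) :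
    ∃ k ∈ K, maxStat K hK Δ x y = √(n : ℝ) * (|empQuantile x k - empQuantile y k| - Δ) := by
  obtain ⟨k, hk, h⟩ := Finset.exists_mem_eq_sup' hK
    (fun k => |empQuantile x k - empQuantile y k| - Δ)
  exact ⟨k, hk, by rw [maxStat, h]⟩

/-- The functional of the two empirical processes which approximates the maximum statistic. -/
noncomputable def signedMax {B : Finset ℝ} (hB : (Finset.univ : Finset B).Nonempty)
    (s dX dY : ℝ → ℝ) (z : EuclideanSpace ℝ (B ⊕ B)) : ℝ :=
  Finset.univ.sup' hB fun k : B =>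
    s k * (-(z (Sum.inl k) / dX k) - -(z (Sum.inr k) / dY k))

lemma continuous_signedMax {B : Finset ℝ} (hB : (Finset.univ : Finset B).Nonempty)
    (s dX dY : ℝ → ℝ) : Continuous (signedMax hB s dX dY) := by
  unfold signedMax
  refine Continuous.finset_sup'_apply hB fun k _ => ?_
  fun_prop

/-- The deterministic part of the reduction: terms outside `B` are dominated by one from `B`, and
those from `B` are close to `L`. -/
lemma abs_sub_sup'_le {ι κ : Type*} {K : Finset ι} {B : Finset κ} (hB : B.Nonempty) {S ε : ℝ}
    {T : ι → ℝ} {e : κ → ι} {L : κ → ℝ} (he : ∀ b ∈ B, e b ∈ K) (hmax : ∀ k ∈ K, T k ≤ S)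
    (hex : ∃ k ∈ K, S = T k) (hTL : ∀ b ∈ B, |T (e b) - L b| ≤ ε)
    (hsmall : ∀ k ∈ K, ∃ b ∈ B, T k ≤ T (e b)) : |S - B.sup' hB L| ≤ ε := by
  rw [abs_le]
  constructor
  · obtain ⟨b, hb, h⟩ := Finset.exists_mem_eq_sup' hB L
    have h1 := (abs_le.mp (hTL b hb)).1
    have h2 := hmax _ (he b hb)
    linarith
  · obtain ⟨k, hk, h⟩ := hex
    obtain ⟨b, hb, hkb⟩ := hsmall k hk
    have h1 := (abs_le.mp (hTL b hb)).2
    have h2 := Finset.le_sup' L hb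
    linarith

end

theorem theorem1 {Ω Ω' : Type*} [MeasurableSpace Ω] [MeasurableSpace Ω']
    (P : Measure Ω) [IsProbabilityMeasure P] (P' : Measure Ω') [IsProbabilityMeasure P']
    (X Y : ℕ → Ω → ℝ) (hX : ∀ i, Measurable (X i)) (hY : ∀ i, Measurable (Y i))
    (m : ℕ) (hstat : StrictlyStationary P X Y) (hdep : MDependent P X Y m)
    (K : Finset ℝ) (hK : K.Nonempty) (hK01 : ∀ k ∈ K, 0 < k ∧ k < 1)
    (fX fY : ℝ → ℝ) (hfX : IsDensity (P.map (X 0)) fX) (hfY : IsDensity (P.map (Y 0)) fY)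
    (hfXpos : ∀ k ∈ K, PosContNear fX (quantile (P.map (X 0)) k))
    (hfYpos : ∀ k ∈ K, PosContNear fY (quantile (P.map (Y 0)) k))
    (G₁ G₂ : ℝ → Ω' → ℝ) (hG : IsLongRunBrownianBridge P X Y m P' G₁ G₂)
    (Δ : ℝ) (hΔ : 0 < Δ)
    (hH0 : K.sup' hK (fun k =>
      |quantile (P.map (X 0)) k - quantile (P.map (Y 0)) k|) ≤ Δ) :
    TendstoInDistribution
      (fun (n : ℕ) (ω : Ω) =>
        ((maxStat K hK Δ (fun i : Fin n => X i ω) (fun i : Fin n => Y i ω) : ℝ) : EReal))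
      atTop
      (limitVar K Δ (P.map (X 0)) (P.map (Y 0)) fX fY G₁ G₂)
      (fun _ => P) P' := by
  have hνX := Measure.isProbabilityMeasure_map (μ := P) (hX 0).aemeasurable
  have hνY := Measure.isProbabilityMeasure_map (μ := P) (hY 0).aemeasurable
  set qX := quantile (P.map (X 0))
  set qY := quantile (P.map (Y 0))
  have hposX : ∀ k ∈ K, 0 < fX (qX k) := fun k hk => by
    obtain ⟨U, hU, -, h⟩ := hfXpos k hk
    exact h _ (mem_of_mem_nhds hU)
  have hposY : ∀ k ∈ K, 0 < fY (qY k) := fun k hk => by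
    obtain ⟨U, hU, -, h⟩ := hfYpos k hk
    exact h _ (mem_of_mem_nhds hU)
  have hdX : ∀ k ∈ K, HasDerivAt (cdf (P.map (X 0))) (fX (qX k)) (qX k) := fun k hk => by
    obtain ⟨U, hU, hc, -⟩ := hfXpos k hk
    exact hfX.hasDerivAt_cdf (hc.continuousAt hU)
  have hdY : ∀ k ∈ K, HasDerivAt (cdf (P.map (Y 0))) (fY (qY k)) (qY k) := fun k hk => by
    obtain ⟨U, hU, hc, -⟩ := hfYpos k hk
    exact hfY.hasDerivAt_cdf (hc.continuousAt hU)
  have hqX : ∀ k ∈ K, cdf (P.map (X 0)) (qX k) = k := fun k hk =>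
    cdf_quantile (hK01 k hk) (hdX k hk).continuousAt
  have hqY : ∀ k ∈ K, cdf (P.map (Y 0)) (qY k) = k := fun k hk =>
    cdf_quantile (hK01 k hk) (hdY k hk).continuousAt
  have hdepX : ∀ g : ℝ → ℝ, Measurable g → (∀ z, |g z| ≤ 4) →
      BoundedMDependent P m 4 fun i ω => g (X i ω) := fun g hg hg4 =>
    BoundedMDependent.of_comp hX hY hstat hdep (hg.comp measurable_fst) fun z => hg4 _
  have hdepY : ∀ g : ℝ → ℝ, Measurable g → (∀ z, |g z| ≤ 4) →
      BoundedMDependent P m 4 fun i ω => g (Y i ω) := fun g hg hg4 =>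
    BoundedMDependent.of_comp hX hY hstat hdep (hg.comp measurable_snd) fun z => hg4 _
  have hbddX : ∀ k ∈ K, BddInProb P fun n ω => -(empDeviation P X n (qX k) ω / fX (qX k)) :=
    fun k hk => bddInProb_neg_empDeviation_div (hX 0) hdepX (hposX k hk) _
  have hbddY : ∀ k ∈ K, BddInProb P fun n ω => -(empDeviation P Y n (qY k) ω / fY (qY k)) :=
    fun k hk => bddInProb_neg_empDeviation_div (hY 0) hdepY (hposY k hk) _
  have hbahX := fun k hk ε (hε : 0 < ε) =>
    whp_abs_empQuantile_sub_le (hX 0) hdepX (hK01 k hk) (hqX k hk) (hposX k hk) (hdX k hk) hε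
  have hbahY := fun k hk ε (hε : 0 < ε) =>
    whp_abs_empQuantile_sub_le (hY 0) hdepY (hK01 k hk) (hqY k hk) (hposY k hk) (hdY k hk) hε
  have hle : ∀ k ∈ K, |qX k - qY k| ≤ Δ := fun k hk =>
    (Finset.le_sup' (fun k => |qX k - qY k|) hk).trans hH0
  have hint : ∀ k ∈ K, |qX k - qY k| ≠ Δ → Whp P fun n ω =>
      √(n : ℝ) * (|empQuantile (fun i : Fin n => X i ω) k -
        empQuantile (fun i : Fin n => Y i ω) k| - Δ) ≤ -(√(n : ℝ) * ((Δ - |qX k - qY k|) / 2)) :=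
    fun k hk hne => whp_interior_level (hbddX k hk) (hbddY k hk) (hbahX k hk) (hbahY k hk)
      (lt_of_le_of_ne (hle k hk) hne)
  set B := boundaryLevels K Δ (P.map (X 0)) (P.map (Y 0)) with hBdef
  have hmemB : ∀ k, k ∈ B ↔ k ∈ K ∧ |qX k - qY k| = Δ := fun k => Finset.mem_filter
  have hlim_atTop : ∀ c : ℝ, 0 < c → Tendsto (fun n : ℕ => √(n : ℝ) * c) atTop atTop :=
    fun c hc => tendsto_sqrt_natCast_atTop.atTop_mul_const hc
  rcases B.eq_empty_or_nonempty with hB | hB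
  · have hlimit : limitVar K Δ (P.map (X 0)) (P.map (Y 0)) fX fY G₁ G₂ = fun _ => ⊥ := by
      funext ω
      rw [limitVar, ← hBdef, hB, Finset.sup_empty]
    rw [hlimit]
    refine tendstoInDistribution_bot_of_whp (fun n => measurable_maxStat K hK Δ n hX hY) fun M => ?_
    have hne : ∀ k ∈ K, |qX k - qY k| ≠ Δ := fun k hk h => by
      have : k ∈ B := (hmemB k).mpr ⟨hk, h⟩
      simp [hB] at this
    refine (whp_forall_finset K fun k hk => hint k hk (hne k hk)).mono ?_
    have hev : ∀ᶠ n : ℕ in atTop, ∀ k ∈ K, -M ≤ √(n : ℝ) * ((Δ - |qX k - qY k|) / 2) := by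
      rw [Filter.eventually_all_finset]
      intro k hk
      have := lt_of_le_of_ne (hle k hk) (hne k hk)
      exact (hlim_atTop _ (by linarith)).eventually_ge_atTop _
    filter_upwards [hev] with n hn ω hω
    obtain ⟨k, hk, h⟩ := exists_maxStat_eq hK Δ (fun i : Fin n => X i ω) (fun i : Fin n => Y i ω)
    rw [h]
    linarith [hω k hk, hn k hk]
  · obtain ⟨k₀, hk₀⟩ := hB
    have hBne : (Finset.univ : Finset B).Nonempty := ⟨⟨k₀, hk₀⟩, Finset.mem_univ _⟩
    have hBK : ∀ k : B, (k : ℝ) ∈ K := fun k => ((hmemB k).mp k.2).1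
    set s : ℝ → ℝ := fun k => Real.sign (qX k - qY k)
    have hIcc : ∀ k : B, (k : ℝ) ∈ Set.Icc (0 : ℝ) 1 := fun k =>
      ⟨(hK01 k (hBK k)).1.le, (hK01 k (hBK k)).2.le⟩
    set g : B ⊕ B → ℝ × ℝ → ℝ :=
      Sum.elim (fun k z => iicInd (qX k) z.1) (fun k z => iicInd (qY k) z.2) with hgdef
    -- The negated bridge has the same covariance, and its sign cancels the minus sign of the
    -- Bahadur representation, so the stated limit variable appears exactly.
    set N : B ⊕ B → Ω' → ℝ := Sum.elim (fun k ω => -G₁ k ω) (fun k ω => -G₂ k ω) with hNdef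
    have hgm : ∀ j, Measurable (g j) := by
      rintro (k | k)
      exacts [(measurable_iicInd _).comp measurable_fst, (measurable_iicInd _).comp measurable_snd]
    have hg1 : ∀ j z, |g j z| ≤ 1 := by
      rintro (k | k) z
      all_goals
        simp only [hgdef, Sum.elim_inl, Sum.elim_inr]
        rw [abs_of_nonneg (iicInd_nonneg _ _)]
        exact iicInd_le_one _ _
    have hN : IsGaussianProcess N P' := by
      have h1 := (hG.gaussian.comp_right
        (Sum.map (fun k : B => (⟨k, hIcc k⟩ : Set.Icc (0 : ℝ) 1))
          (fun k : B => (⟨k, hIcc k⟩ : Set.Icc (0 : ℝ) 1)))).smul fun _ => -1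
      refine h1.congr fun j => ae_of_all _ fun ω => ?_
      rcases j with k | k <;> simp [hNdef]
    have hmean : ∀ j, ∫ ω, N j ω ∂P' = 0 := by
      rintro (k | k)
      · simp only [hNdef, Sum.elim_inl, integral_neg, hG.mean_fst k (hIcc k), neg_zero]
      · simp only [hNdef, Sum.elim_inr, integral_neg, hG.mean_snd k (hIcc k), neg_zero]
    have hlX : ∀ k : B, levelInd P X k = fun i ω => iicInd (qX k) (X i ω) := fun k =>
      levelInd_eq_iicInd (hqX k (hBK k)) (hposX k (hBK k)) (hdX k (hBK k))
    have hlY : ∀ k : B, levelInd P Y k = fun i ω => iicInd (qY k) (Y i ω) := fun k =>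
      levelInd_eq_iicInd (hqY k (hBK k)) (hposY k (hBK k)) (hdY k (hBK k))
    have hcov : ∀ j l, cov[N j, N l; P'] = longRunCov P m (fun i ω => g j (X i ω, Y i ω))
        (fun i ω => g l (X i ω, Y i ω)) := by
      rintro (k | k) (l | l)
      · simp only [hNdef, hgdef, Sum.elim_inl, covariance_fun_neg_left, covariance_fun_neg_right,
          neg_neg]
        rw [← hlX k, ← hlX l]
        exact hG.cov_fst k (hIcc k) l (hIcc l)
      · simp only [hNdef, hgdef, Sum.elim_inl, Sum.elim_inr, covariance_fun_neg_left,
          covariance_fun_neg_right, neg_neg]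
        rw [← hlX k, ← hlY l]
        exact hG.cov_fst_snd k (hIcc k) l (hIcc l)
      · simp only [hNdef, hgdef, Sum.elim_inl, Sum.elim_inr, covariance_fun_neg_left,
          covariance_fun_neg_right, neg_neg]
        rw [← hlY k, ← hlX l, covariance_comm, longRunCov_comm]
        exact hG.cov_fst_snd l (hIcc l) k (hIcc k)
      · simp only [hNdef, hgdef, Sum.elim_inr, covariance_fun_neg_left, covariance_fun_neg_right,
          neg_neg]
        rw [← hlY k, ← hlY l]
        exact hG.cov_snd k (hIcc k) l (hIcc l)
    have clt := (tendstoInDistribution_multivariate hX hY hstat hdep hgm hg1 hN hmean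
      hcov).continuous_comp (continuous_signedMax hBne s (fun k => fX (qX k)) (fun k => fY (qY k)))
    set L : ℕ → Ω → ℝ := fun n ω => Finset.univ.sup' hBne fun k : B =>
      s k * (-(empDeviation P X n (qX k) ω / fX (qX k)) - -(empDeviation P Y n (qY k) ω / fY (qY k)))
    have hconv : TendstoInDistribution L atTop (fun ω => Finset.univ.sup' hBne fun k : B =>
        s k * (G₁ k ω / fX (qX k) - G₂ k ω / fY (qY k))) (fun _ => P) P' := by
      convert clt using 1
      · funext n ω
        simp only [L, signedMax, Function.comp, empDeviation, hgdef, Sum.elim_inl, Sum.elim_inr,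
          integral_iicInd (hX 0), integral_iicInd (hY 0)]
      · funext ω
        simp only [signedMax, Function.comp, hNdef, Sum.elim_inl, Sum.elim_inr]
        congr 1
        funext k
        ring
    have happrox : ∀ ε > 0, Whp P fun n ω =>
        |maxStat K hK Δ (fun i : Fin n => X i ω) (fun i : Fin n => Y i ω) - L n ω| ≤ ε := by
      intro ε hε
      have hbdry : ∀ k ∈ B, ∀ ε > 0, Whp P fun n ω =>
          |√(n : ℝ) * (|empQuantile (fun i : Fin n => X i ω) k -
            empQuantile (fun i : Fin n => Y i ω) k| - Δ) - s k *
            (-(empDeviation P X n (qX k) ω / fX (qX k)) -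
              -(empDeviation P Y n (qY k) ω / fY (qY k)))| ≤ ε := fun k hk ε hε =>
        have hkK := ((hmemB k).mp hk).1
        whp_boundary_level (hbddX k hkK) (hbddY k hkK) (hbahX k hkK) (hbahY k hkK) hΔ
          ((hmemB k).mp hk).2 hε
      have hk₀K := ((hmemB k₀).mp hk₀).1
      have hk₀bdd : BddInProb P fun n ω => √(n : ℝ) * (|empQuantile (fun i : Fin n => X i ω) k₀ -
            empQuantile (fun i : Fin n => Y i ω) k₀| - Δ) :=
        (((hbddX k₀ hk₀K).sub (hbddY k₀ hk₀K)).of_abs_le fun n ω =>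
          abs_sign_mul_le (qX k₀ - qY k₀) _).of_whp_sub (hbdry k₀ hk₀ 1 one_pos)
      -- A single boundary level `k₀` beats all interior levels: its term is tight while theirs tend
      -- to `-∞`.
      have hsmall : ∀ k ∈ K, Whp P fun n ω => |qX k - qY k| ≠ Δ →
          √(n : ℝ) * (|empQuantile (fun i : Fin n => X i ω) k -
            empQuantile (fun i : Fin n => Y i ω) k| - Δ) ≤
          √(n : ℝ) * (|empQuantile (fun i : Fin n => X i ω) k₀ -
            empQuantile (fun i : Fin n => Y i ω) k₀| - Δ) := by
        intro k hk
        by_cases hne : |qX k - qY k| = Δ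
        · exact whp_of_eventually (Eventually.of_forall fun n ω h => absurd hne h)
        · have hlt := lt_of_le_of_ne (hle k hk) hne
          refine ((hint k hk hne).and
            (hk₀bdd.whp (hlim_atTop ((Δ - |qX k - qY k|) / 2) (by linarith)))).mono
            (Eventually.of_forall fun n ω h _ => ?_)
          exact h.1.trans (abs_le.mp h.2).1
      refine ((whp_forall_finset B fun k hk => hbdry k hk ε hε).and
        (whp_forall_finset K hsmall)).mono (Eventually.of_forall fun n ω h => ?_)
      refine abs_sub_sup'_le hBne (e := fun k : B => (k : ℝ)) (K := K)
        (T := fun k => √(n : ℝ) * (|empQuantile (fun i : Fin n => X i ω) k -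
            empQuantile (fun i : Fin n => Y i ω) k| - Δ))
        (fun b _ => hBK b) (fun k hk => le_maxStat hK Δ _ _ hk) (exists_maxStat_eq hK Δ _ _)
        (fun b _ => h.1 b b.2) fun k hk => ?_
      by_cases hkΔ : |qX k - qY k| = Δ
      · exact ⟨⟨k, (hmemB k).mpr ⟨hk, hkΔ⟩⟩, Finset.mem_univ _, le_rfl⟩
      · exact ⟨⟨k₀, hk₀⟩, Finset.mem_univ _, h.2 k hk hkΔ⟩
    have hreal := tendstoInDistribution_of_tendstoInMeasure_sub
      (fun (n : ℕ) ω => maxStat K hK Δ (fun i : Fin n => X i ω) (fun i : Fin n => Y i ω)) _ hconv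
      (tendstoInMeasure_zero_of_whp happrox)
      fun n => (measurable_maxStat K hK Δ n hX hY).aemeasurable
    have hE := hreal.continuous_comp (g := fun x : ℝ => (x : EReal)) continuous_coe_real_ereal
    convert hE using 1
    · rfl
    funext ω
    rw [limitVar, ← hBdef, Function.comp, Finset.apply_sup'_eq_sup'_comp (g := fun x : ℝ => (x : EReal))
      hBne (fun x y => EReal.coe_strictMono.monotone.map_sup x y), Finset.sup'_eq_sup,
      ← Finset.sup_attach B]
    rfl
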